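/- Let $I\subseteq\mathbb{R}$ be an interval with more than one point (for example $I=\mathbb{R}$ or a compact interval). The Geroch group $G$ is the group of smooth maps $s:I\to SL(2,\mathbb{R})$ under pointwise multiplication, and the phase space $\Gamma$ is the set of smooth functions $\mathcal{M}$ from $I$ to the real symmetric positive definite $2\times2$ matrices of determinant $1$. The group $G$ acts on $\Gamma$ by $(s\triangleright\mathcal{M})(w)=s(w)\,\mathcal{M}(w)\,s(w)^t$. An observable on $G$ or $\Gamma$ is a real functional $F$ which at each point $x$ has a functional derivative $\delta F/\delta x$, that is, a smooth $2\times 2$ matrix function with compact support in the interior of $I$ such that $\frac{d}{dt}F(x_t)|_{t=0}=\int\sum_{ij}\frac{\delta F}{\delta x(w)_{ij}}\,\partial_t x_t(w)_{ij}|_{t=0}\,dw$ for every smooth curve $x_t$ with $x_0=x$. For matrices $A,B$ write $\overset{1}{A}=A\otimes 1$ and $\overset{2}{B}=1\otimes B$; let $\Omega_a{}^b{}_c{}^d=\delta_a^d\delta_c^b-\frac12\delta_a^b\delta_c^d$ be the Casimir element of $\mathfrak{sl}_2$, and let ${}^t\Omega$, $\Omega^t$, ${}^t\Omega^t$ denote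 its transposes in space $1$, in space $2$, and in both. The Poisson bracket on $\Gamma$ is $$\{A,B\}_\Gamma=\iint \frac{\delta A}{\delta\mathcal{M}(v)_{ab}}\,\frac{\delta B}{\delta\mathcal{M}(w)_{cd}}\,\{\mathcal{M}(v)_{ab},\mathcal{M}(w)_{cd}\}\,dv\,dw,$$ $$\{\overset{1}{\mathcal{M}}(v),\overset{2}{\mathcal{M}}(w)\}=\mathrm{p.v.}\Big(\frac1{v-w}\Big)\Big[\Omega\overset{1}{\mathcal{M}}(v)\overset{2}{\mathcal{M}}(w)+\overset{1}{\mathcal{M}}(v)\,{}^t\Omega\,\overset{2}{\mathcal{M}}(w)+\overset{2}{\mathcal{M}}(w)\,\Omega^t\,\overset{1}{\mathcal{M}}(v)+\overset{1}{\mathcal{M}}(v)\overset{2}{\mathcal{M}}(w)\,{}^t\Omega^t\Big],$$ where $\mathrm{p.v.}\frac1u=\lim_{\epsilon\to0^+}\frac12\big(\frac1{u+i\epsilon}+\frac1{u-i\epsilon}\big)$ as a distribution. Let $\{\cdot,\cdot\}_G$ be any bracket on $G$: a skew-symmetric bilinear operation, taking pairs of observables on $G$ to functions on $G$, that satisfies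 the Leibniz rule and depends at each point of $G$ on the observables only through their functional derivatives at that point. (The Jacobi identity is not required, so every Poisson bracket is included.) Then the action is a Poisson map $G\times\Gamma\to\Gamma$, meaning that $$\{A,B\}_\Gamma(g\triangleright\xi)=\{A(g\triangleright\cdot),B(g\triangleright\cdot)\}_\Gamma(\xi)+\{A(\cdot\triangleright\xi),B(\cdot\triangleright\xi)\}_G(g)$$ for all observables $A,B$ on $\Gamma$, all $g\in G$ and all $\xi\in\Gamma$, if and only if $\{\cdot,\cdot\}_G$ is the Sklyanin bracket, $$\{\overset{1}{s}(v),\overset{2}{s}(w)\}_G=\mathrm{p.v.}\Big(\frac1{v-w}\Big)\big[\Omega,\overset{1}{s}(v)\overset{2}{s}(w)\big],$$ as an identity between distributions in $v$ and $w$ (that is, after integration against $\varphi(v)\psi(w)$ for all smooth $\varphi,\psi$ with compact support in the interior of $I$). Moreover, a bracket on $G$ with this property exists. -/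

import Mathlib

open MeasureTheory Filter Topology Matrix
open scoped ContDiff Kronecker MatrixGroups

noncomputable section

namespace Geroch

/-- Real `2 × 2` matrices. -/
abbrev Mat : Type := Matrix (Fin 2) (Fin 2) ℝ

/-- Matrices acting on the tensor product of two copies of `ℝ²` (space 1 ⊗ space 2). A tensor
`X_a^b_c^d`, with `a, b` referring to space 1 and `c, d` to space 2, has entry `X (a, c) (b, d)`. -/
abbrev Mat₂ : Type := Matrix (Fin 2 × Fin 2) (Fin 2 × Fin 2) ℝ

/-- A matrix valued function is smooth on `I` if all its matrix elements are. -/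
def SmoothOn (I : Set ℝ) (m : ℝ → Mat) : Prop :=
  ∀ i j, ContDiffOn ℝ ∞ (fun w => m w i j) I

theorem SmoothOn.mul {I : Set ℝ} {m n : ℝ → Mat} (hm : SmoothOn I m) (hn : SmoothOn I n) :
    SmoothOn I (fun w => m w * n w) := by
  intro i j
  simp only [Matrix.mul_apply]
  exact ContDiffOn.sum fun k _ => (hm i k).mul (hn k j)

theorem SmoothOn.transpose {I : Set ℝ} {m : ℝ → Mat} (hm : SmoothOn I m) :
    SmoothOn I (fun w => (m w)ᵀ) := fun i j => hm j i

theorem SmoothOn.adjugate {I : Set ℝ} {m : ℝ → Mat} (hm : SmoothOn I m) :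
    SmoothOn I (fun w => (m w).adjugate) := by
  intro i j
  simp only [Matrix.adjugate_fin_two]
  fin_cases i <;> fin_cases j <;> simp
  · exact hm 1 1
  · exact (hm 0 1).neg
  · exact (hm 1 0).neg
  · exact hm 0 0

/-! ### The Geroch group, the phase space and the action

`I` is the interval on which the spectral parameter `w` ranges (`I = Set.univ` for the whole
line). A function on `I` is represented by its extension to `ℝ` with the dummy value `1`
off `I`; nothing below looks at the values off `I`. -/

/-- The Geroch group: the smooth functions `s : I → SL(2, ℝ)` under pointwise multiplication. -/
def Group (I : Set ℝ) : Subgroup (ℝ → SL(2, ℝ)) where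
  carrier := {s | SmoothOn I (fun w => (s w : Mat)) ∧ ∀ w, w ∉ I → s w = 1}
  mul_mem' := by
    rintro s t ⟨hs, hs'⟩ ⟨ht, ht'⟩
    refine ⟨?_, fun w hw => by simp [hs' w hw, ht' w hw]⟩
    simpa using hs.mul ht
  one_mem' := ⟨fun i j => by simpa using contDiffOn_const, fun _ _ => rfl⟩
  inv_mem' := by
    rintro s ⟨hs, hs'⟩
    refine ⟨?_, fun w hw => by simp [hs' w hw]⟩
    simpa [Matrix.SpecialLinearGroup.coe_inv] using hs.adjugate

/-- The phase space `Γ` of deformed metrics: the smooth functions from `I` to the real symmetric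
positive definite matrices of determinant `1`. -/
def PhaseSpace (I : Set ℝ) : Type :=
  {M : ℝ → Mat // SmoothOn I M ∧ (∀ w, (M w).PosDef ∧ (M w).det = 1) ∧ ∀ w, w ∉ I → M w = 1}

/-- The matrix elements of `s` as functions of `w`, the coordinates on the Geroch group. -/
def groupCoord (I : Set ℝ) (s : Group I) (w : ℝ) : Mat := ((s : ℝ → SL(2, ℝ)) w : Mat)

/-- The matrix elements of `M` as functions of `w`, the coordinates on the phase space. -/
def phaseCoord (I : Set ℝ) (M : PhaseSpace I) (w : ℝ) : Mat := M.1 w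

/-- The action `M(w) ↦ s(w) M(w) s(w)ᵗ` of the Geroch group on the phase space. -/
instance (I : Set ℝ) : MulAction (Group I) (PhaseSpace I) where
  smul s M := ⟨fun w => groupCoord I s w * M.1 w * (groupCoord I s w)ᵀ, by
    obtain ⟨M, hM, hM', hM''⟩ := M
    obtain ⟨s, hs, hs'⟩ := s
    refine ⟨(hs.mul hM).mul hs.transpose, fun w => ⟨?_, ?_⟩, fun w hw => ?_⟩
    · have h := (hM' w).1.mul_mul_conjTranspose_same (B := (s w : Mat)) (by
        apply Matrix.vecMul_injective_of_isUnit
        rw [Matrix.isUnit_iff_isUnit_det]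
        simp)
      simpa [groupCoord, Matrix.conjTranspose_eq_transpose_of_trivial] using h
    · simp [groupCoord, (hM' w).2]
    · simp [groupCoord, hs' w hw, hM'' w hw]⟩
  one_smul M := Subtype.ext (funext fun w => by
    change groupCoord I 1 w * M.1 w * (groupCoord I 1 w)ᵀ = M.1 w
    simp [groupCoord])
  mul_smul s t M := Subtype.ext (funext fun w => by
    change groupCoord I (s * t) w * M.1 w * (groupCoord I (s * t) w)ᵀ =
      groupCoord I s w * (groupCoord I t w * M.1 w * (groupCoord I t w)ᵀ) * (groupCoord I s w)ᵀ
    simp [groupCoord, Matrix.transpose_mul, Matrix.mul_assoc])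

/-! ### Observables

`X` is a space of matrix valued functions on `I` (the Geroch group or the phase space) and
`e : X → ℝ → Mat` gives the matrix elements of its points. -/

/-- Matrix valued test functions: smooth, with compact support in the interior of `I`. -/
def IsTest (I : Set ℝ) (φ : ℝ → Mat) : Prop :=
  (∀ i j, ContDiff ℝ ∞ (fun w => φ w i j)) ∧ HasCompactSupport φ ∧ tsupport φ ⊆ interior I

/-- A curve in `X` is smooth if its matrix elements are jointly smooth in the curve parameter
and the spectral parameter. -/
def IsSmoothCurve (I : Set ℝ) {X : Type} (e : X → ℝ → Mat) (c : ℝ → X) : Prop :=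
  ∀ i j, ContDiffOn ℝ ∞ (fun p : ℝ × ℝ => e (c p.1) p.2 i j) (Set.univ ×ˢ I)

/-- `φ` is a functional derivative `δF/δx` of `F` at `x`: it is a test function, and along every
smooth curve `x_t` with `x_0 = x` the derivative of `F (x_t)` at `t = 0` is
`∫ ∑ φ(w)_{ij} (d/dt) x_t(w)_{ij} dw`. -/
def HasFunctionalDeriv (I : Set ℝ) {X : Type} (e : X → ℝ → Mat) (F : X → ℝ) (x : X)
    (φ : ℝ → Mat) : Prop :=
  IsTest I φ ∧ ∀ c : ℝ → X, IsSmoothCurve I e c → c 0 = x →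
    HasDerivAt (fun t => F (c t))
      (∫ w, ∑ i, ∑ j, φ w i j * deriv (fun t => e (c t) w i j) 0) 0

/-- An observable: a functional with a smooth, compactly supported functional derivative at
each point of `X`. -/
def IsObservable (I : Set ℝ) {X : Type} (e : X → ℝ → Mat) (F : X → ℝ) : Prop :=
  ∀ x, ∃ φ, HasFunctionalDeriv I e F x φ

open Classical in
/-- A choice of functional derivative at `x`, and `0` if there is none. (The matrix elements are
subject to `det = 1`, and in `Γ` to symmetry, so that functional derivatives are unique only up to
terms that annihilate the tangent vectors. The brackets below are insensitive to these.) -/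
def functionalDeriv (I : Set ℝ) {X : Type} (e : X → ℝ → Mat) (F : X → ℝ) (x : X) : ℝ → Mat :=
  if h : ∃ φ, HasFunctionalDeriv I e F x φ then h.choose else 0

/-- The matrix elements of `x` smeared with the test function `φ`. -/
def smear {X : Type} (e : X → ℝ → Mat) (φ : ℝ → Mat) (x : X) : ℝ :=
  ∫ w, ∑ i, ∑ j, φ w i j * e x w i j

/-! ### Brackets -/

/-- The value on the test function `f(v, w)` of the principal value distribution
`p.v. 1/(v - w)`, the limit as `ε → 0⁺` of
`1/2 (1/(v - w + iε) + 1/(v - w - iε)) = (v - w) / ((v - w)² + ε²)`. -/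
def pv (f : ℝ → ℝ → ℝ) : ℝ :=
  limUnder (𝓝[>] (0 : ℝ)) fun ε : ℝ =>
    ∫ p : ℝ × ℝ, (p.1 - p.2) / ((p.1 - p.2) ^ 2 + ε ^ 2) * f p.1 p.2

/-- The limit that defines the principal value exists for compactly supported `C¹` functions. -/
theorem exists_tendsto_pv (f : ℝ → ℝ → ℝ) (hf : ContDiff ℝ 1 fun p : ℝ × ℝ => f p.1 p.2)
    (hf' : HasCompactSupport fun p : ℝ × ℝ => f p.1 p.2) :
    ∃ L, Tendsto (fun ε : ℝ =>
      ∫ p : ℝ × ℝ, (p.1 - p.2) / ((p.1 - p.2) ^ 2 + ε ^ 2) * f p.1 p.2) (𝓝[>] 0) (𝓝 L) := by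
  obtain ⟨C, hC⟩ := hf.lipschitzWith_of_hasCompactSupport hf' one_ne_zero
  set g : ℝ × ℝ → ℝ := fun p => f p.1 p.2 with hg
  have hgc : Continuous g := hf.continuous
  set K : Set (ℝ × ℝ) := tsupport g ∪ Prod.swap ⁻¹' tsupport g with hK
  have hKc : IsCompact K := by
    refine hf'.isCompact.union ?_
    have : Prod.swap ⁻¹' tsupport g = Prod.swap '' tsupport g :=
      (Set.image_swap_eq_preimage_swap).symm ▸ rfl
    rw [this]
    exact hf'.isCompact.image continuous_swap
  have hk : ∀ ε : ℝ, 0 < ε → Continuous fun p : ℝ × ℝ => (p.1 - p.2) / ((p.1 - p.2) ^ 2 + ε ^ 2) := by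
    intro ε hε
    refine Continuous.div (by fun_prop) (by fun_prop) fun p => by positivity
  refine ⟨∫ p : ℝ × ℝ, 1 / 2 * (1 / (p.1 - p.2) * (g p - g p.swap)), ?_⟩
  have key : Tendsto (fun ε : ℝ => ∫ p : ℝ × ℝ,
      1 / 2 * ((p.1 - p.2) / ((p.1 - p.2) ^ 2 + ε ^ 2) * (g p - g p.swap))) (𝓝[>] 0)
      (𝓝 (∫ p : ℝ × ℝ, 1 / 2 * (1 / (p.1 - p.2) * (g p - g p.swap)))) := by
    refine tendsto_integral_filter_of_dominated_convergence (K.indicator fun _ => (C : ℝ))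
      ?_ ?_ ?_ ?_
    · filter_upwards [self_mem_nhdsWithin] with ε hε
      have h1 := hk ε hε
      exact (Continuous.mul continuous_const
        (h1.mul (hgc.sub (hgc.comp continuous_swap)))).aestronglyMeasurable
    · filter_upwards [self_mem_nhdsWithin] with ε (hε : 0 < ε)
      refine Eventually.of_forall fun p => ?_
      by_cases hp : p ∈ K
      · rw [Set.indicator_of_mem hp]
        have hd : |g p - g p.swap| ≤ C * |p.1 - p.2| := by
          have := hC.dist_le_mul p p.swap
          rwa [Real.dist_eq, Prod.dist_eq, Prod.fst_swap, Prod.snd_swap, Real.dist_eq, Real.dist_eq,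
            abs_sub_comm p.2 p.1, max_self] at this
        have hpos : 0 < (p.1 - p.2) ^ 2 + ε ^ 2 := by positivity
        rw [Real.norm_eq_abs, abs_mul, abs_mul, abs_of_pos (by norm_num : (0 : ℝ) < 1 / 2),
          abs_div, abs_of_pos hpos]
        have : |p.1 - p.2| / ((p.1 - p.2) ^ 2 + ε ^ 2) * |g p - g p.swap| ≤ C := by
          rw [div_mul_eq_mul_div, div_le_iff₀ hpos]
          calc |p.1 - p.2| * |g p - g p.swap| ≤ |p.1 - p.2| * (C * |p.1 - p.2|) := by gcongr
            _ = C * (p.1 - p.2) ^ 2 := by rw [← sq_abs (p.1 - p.2)]; ring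
            _ ≤ C * ((p.1 - p.2) ^ 2 + ε ^ 2) := by
              gcongr
              nlinarith
        have h0 : 0 ≤ |p.1 - p.2| / ((p.1 - p.2) ^ 2 + ε ^ 2) * |g p - g p.swap| := by positivity
        linarith
      · have h1 : g p = 0 := image_eq_zero_of_notMem_tsupport fun h => hp (Or.inl h)
        have h2 : g p.swap = 0 := image_eq_zero_of_notMem_tsupport fun h => hp (Or.inr h)
        simp [Set.indicator_of_notMem hp, h1, h2]
    · rw [integrable_indicator_iff hKc.measurableSet]
      exact integrableOn_const hKc.measure_lt_top.ne
    · refine Eventually.of_forall fun p => ?_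
      refine Tendsto.const_mul _ (Tendsto.mul_const _ ?_)
      rcases eq_or_ne (p.1 - p.2) 0 with h | h
      · simp [h]
      · have : Tendsto (fun ε : ℝ => (p.1 - p.2) / ((p.1 - p.2) ^ 2 + ε ^ 2)) (𝓝 0)
            (𝓝 ((p.1 - p.2) / ((p.1 - p.2) ^ 2 + 0 ^ 2))) := by
          refine Tendsto.div tendsto_const_nhds
            (Continuous.tendsto (by fun_prop : Continuous fun ε : ℝ => (p.1 - p.2) ^ 2 + ε ^ 2) 0)
            (by positivity)
        have e : (p.1 - p.2) / ((p.1 - p.2) ^ 2 + 0 ^ 2) = 1 / (p.1 - p.2) := by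
          field_simp; simp
        rw [e] at this
        exact this.mono_left nhdsWithin_le_nhds
  refine key.congr' ?_
  filter_upwards [self_mem_nhdsWithin] with ε (hε : 0 < ε)
  have hi : Integrable fun p : ℝ × ℝ => (p.1 - p.2) / ((p.1 - p.2) ^ 2 + ε ^ 2) * g p :=
    ((hk ε hε).mul hgc).integrable_of_hasCompactSupport hf'.mul_left
  have hs : ∫ p : ℝ × ℝ, (p.1 - p.2) / ((p.1 - p.2) ^ 2 + ε ^ 2) * g p.swap =
      -∫ p : ℝ × ℝ, (p.1 - p.2) / ((p.1 - p.2) ^ 2 + ε ^ 2) * g p := by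
    rw [Measure.volume_eq_prod, ← integral_prod_swap, ← integral_neg]
    refine integral_congr_ae (Eventually.of_forall fun p => ?_)
    simp only [Prod.fst_swap, Prod.snd_swap, Prod.swap_swap]
    rw [← neg_sub p.1 p.2, neg_sq]
    ring
  have hi' : Integrable fun p : ℝ × ℝ => (p.1 - p.2) / ((p.1 - p.2) ^ 2 + ε ^ 2) * g p.swap := by
    have := hi.neg.swap
    refine this.congr (Eventually.of_forall fun p => ?_)
    simp only [Function.comp, Pi.neg_apply, Prod.fst_swap, Prod.snd_swap]
    rw [← neg_sub p.1 p.2, neg_sq]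
    ring
  rw [integral_const_mul]
  simp only [mul_sub]
  rw [integral_sub hi hi', hs]
  ring

theorem tendsto_pv (f : ℝ → ℝ → ℝ) (hf : ContDiff ℝ 1 fun p : ℝ × ℝ => f p.1 p.2)
    (hf' : HasCompactSupport fun p : ℝ × ℝ => f p.1 p.2) :
    Tendsto (fun ε : ℝ =>
      ∫ p : ℝ × ℝ, (p.1 - p.2) / ((p.1 - p.2) ^ 2 + ε ^ 2) * f p.1 p.2) (𝓝[>] 0) (𝓝 (pv f)) :=
  tendsto_nhds_limUnder (exists_tendsto_pv f hf hf')

/-- The contraction `∑ φ(v)_{ab} ψ(w)_{cd} K(v, w)_{ab,cd}`, a function of `v` and `w`. -/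
def contract (φ ψ : ℝ → Mat) (K : ℝ → ℝ → Mat₂) (v w : ℝ) : ℝ :=
  ∑ a, ∑ b, ∑ c, ∑ d, φ v a b * ψ w c d * K v w (a, c) (b, d)

/-- The Casimir element `Ω_a^b_c^d = δ_a^d δ_c^b - (1/2) δ_a^b δ_c^d` of `sl₂`. -/
def Ω : Mat₂ := Matrix.of fun p q =>
  (if p.1 = q.2 then 1 else 0) * (if p.2 = q.1 then 1 else 0)
    - 1 / 2 * ((if p.1 = q.1 then 1 else 0) * (if p.2 = q.2 then 1 else 0))

/-- Transposition in the indices of space 1. -/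
def transpose₁ (X : Mat₂) : Mat₂ := Matrix.of fun p q => X (q.1, p.2) (p.1, q.2)

/-- Transposition in the indices of space 2. -/
def transpose₂ (X : Mat₂) : Mat₂ := Matrix.of fun p q => X (p.1, q.2) (q.1, p.2)

/-- A matrix acting on space 1. -/
def in₁ (A : Mat) : Mat₂ := A ⊗ₖ (1 : Mat)

/-- A matrix acting on space 2. -/
def in₂ (A : Mat) : Mat₂ := (1 : Mat) ⊗ₖ A

/-- The coefficient of `p.v. 1/(v - w)` in the bracket `{M¹(v), M²(w)}` on the phase space. -/
def phaseKernel (I : Set ℝ) (M : PhaseSpace I) (v w : ℝ) : Mat₂ :=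
  let M₁ := in₁ (phaseCoord I M v)
  let M₂ := in₂ (phaseCoord I M w)
  Ω * M₁ * M₂ + M₁ * transpose₁ Ω * M₂ + M₂ * transpose₂ Ω * M₁
    + M₁ * M₂ * transpose₁ (transpose₂ Ω)

/-- The Poisson bracket on the phase space,
`{A, B}_Γ = ∬ (δA/δM(v)_{ab}) (δB/δM(w)_{cd}) {M(v)_{ab}, M(w)_{cd}} dv dw`. -/
def phaseBracket (I : Set ℝ) (A B : PhaseSpace I → ℝ) (M : PhaseSpace I) : ℝ :=
  pv (contract (functionalDeriv I (phaseCoord I) A M) (functionalDeriv I (phaseCoord I) B M)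
    (phaseKernel I M))

/-- The commutator `[Ω, s¹(v) s²(w)]`. -/
def sklyaninKernel (I : Set ℝ) (s : Group I) (v w : ℝ) : Mat₂ :=
  let s₁ := in₁ (groupCoord I s v)
  let s₂ := in₂ (groupCoord I s w)
  Ω * (s₁ * s₂) - (s₁ * s₂) * Ω

/-- A bracket on the Geroch group: a skew-symmetric bilinear operation on observables that
satisfies the Leibniz rule and, more generally, the chain rule, i.e. at each point it depends on
the observables only through their functional derivatives there. These are the properties of a
Poisson bracket except for the Jacobi identity, which is not required, so that all Poisson
brackets are included. Only the values of `br` on observables matter. -/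
structure Bracket (I : Set ℝ) where
  br : (Group I → ℝ) → (Group I → ℝ) → Group I → ℝ
  skew : ∀ A B, IsObservable I (groupCoord I) A → IsObservable I (groupCoord I) B →
    ∀ s, br A B s = -br B A s
  add_left : ∀ A A' B, IsObservable I (groupCoord I) A → IsObservable I (groupCoord I) A' →
    IsObservable I (groupCoord I) B → ∀ s, br (A + A') B s = br A B s + br A' B s
  smul_left : ∀ (r : ℝ) A B, IsObservable I (groupCoord I) A →
    IsObservable I (groupCoord I) B → ∀ s, br (r • A) B s = r * br A B s
  leibniz : ∀ A A' B, IsObservable I (groupCoord I) A → IsObservable I (groupCoord I) A' →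
    IsObservable I (groupCoord I) B → ∀ s, br (A * A') B s = A s * br A' B s + A' s * br A B s
  chain : ∀ A A' B, IsObservable I (groupCoord I) A → IsObservable I (groupCoord I) A' →
    IsObservable I (groupCoord I) B → ∀ s φ, HasFunctionalDeriv I (groupCoord I) A s φ →
      HasFunctionalDeriv I (groupCoord I) A' s φ → br A B s = br A' B s

/-- The action `G × Γ → Γ` is a Poisson map: for all observables `A, B` on `Γ`,
`{A, B}_Γ (g ▷ ξ) = {A^G(g, ·), B^G(g, ·)}_Γ (ξ) + {A^G(·, ξ), B^G(·, ξ)}_G (g)`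
with `A^G(g, ξ) = A (g ▷ ξ)`. -/
def Bracket.ActionIsPoisson {I : Set ℝ} (P : Bracket I) : Prop :=
  ∀ A B : PhaseSpace I → ℝ, IsObservable I (phaseCoord I) A → IsObservable I (phaseCoord I) B →
    ∀ (g : Group I) (ξ : PhaseSpace I),
      phaseBracket I A B (g • ξ) =
        phaseBracket I (fun η => A (g • η)) (fun η => B (g • η)) ξ
          + P.br (fun h => A (h • ξ)) (fun h => B (h • ξ)) g

/-- The bracket is the Sklyanin bracket: `{s¹(v), s²(w)}_G = p.v. 1/(v - w) [Ω, s¹(v) s²(w)]`,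
as an identity between distributions in `v` and `w`. -/
def Bracket.IsSklyanin {I : Set ℝ} (P : Bracket I) : Prop :=
  ∀ φ ψ : ℝ → Mat, IsTest I φ → IsTest I ψ → ∀ s : Group I,
    P.br (smear (groupCoord I) φ) (smear (groupCoord I) ψ) s
      = pv (contract φ ψ (sklyaninKernel I s))

end Geroch

end

/-!
Write `⟨X, Y⟩ = tr (X Y) - (tr X) (tr Y) / 2` for the contraction with the Casimir element, and
`(X, Y)` for the skew-symmetric form `∬ p.v. 1/(v - w) ⟨X(v), Y(w)⟩ dv dw` on test functions. The
phase space bracket at `M` is `(m φ, m ψ)` for the momentum `m φ = M (φ + φᵗ)`, while the Sklyanin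
bracket at `s` is the difference of `(l φ, l ψ)` and `(r φ, r ψ)` for the left and right momenta
`l φ = s φᵗ` and `r φ = φᵗ s`. Pulling a covector `φ` at `g ▷ ξ` back to `g` along `h ↦ h ▷ ξ`
yields a covector whose left momentum is the phase space momentum of `φ` at `g ▷ ξ`, and whose right
momentum is the phase space momentum at `ξ` of the pullback of `φ` under `g`. Hence the Poisson
property says exactly that `{·, ·}_G` agrees with the Sklyanin bracket on pairs of covectors pulled
back from a common `ξ`, so it holds for the Sklyanin bracket.

For the converse, a covector at `g` is pulled back from `ξ` if and only if its right momentum `X`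
makes `X ξ` symmetric. For constant `ξ` and `X = f E`, `Y = h F` with scalar functions `f`, `h` this
only asks that `E ξ` and `F ξ` be symmetric, and such a `ξ` exists for all pairs `(E, F)` in
some open set. A bilinear form that vanishes on an open set is zero, and sums of functions
`f E` exhaust the covectors, so the bracket is determined.

A functional derivative is unique only up to a covector whose momenta have scalar values. The forms
above annihilate these because `⟨1, Y⟩ = 0`, so they descend to observables.
-/

namespace Geroch

/-! ### Test functions -/

/-- Entrywise smoothness of a matrix valued function on a subset of a normed space. Both
`SmoothOn I m` and `IsSmoothCurve I e c` unfold to instances of it. -/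
def EntrySmooth {E : Type*} [NormedAddCommGroup E] [NormedSpace ℝ E] (S : Set E) (m : E → Mat) :
    Prop :=
  ∀ i j, ContDiffOn ℝ ∞ (fun p => m p i j) S

namespace EntrySmooth

variable {E : Type*} [NormedAddCommGroup E] [NormedSpace ℝ E] {S : Set E} {m n : E → Mat}

theorem mul (hm : EntrySmooth S m) (hn : EntrySmooth S n) :
    EntrySmooth S (fun p => m p * n p) := by
  intro i j
  simp only [Matrix.mul_apply]
  exact ContDiffOn.sum fun k _ => (hm i k).mul (hn k j)

theorem add (hm : EntrySmooth S m) (hn : EntrySmooth S n) : EntrySmooth S (fun p => m p + n p) :=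
  fun i j => (hm i j).add (hn i j)

theorem transpose (hm : EntrySmooth S m) : EntrySmooth S (fun p => (m p)ᵀ) :=
  fun i j => hm j i

theorem const (A : Mat) : EntrySmooth S (fun _ => A) :=
  fun _ _ => contDiffOn_const

theorem smul {f : E → ℝ} (hf : ContDiffOn ℝ ∞ f S) (hm : EntrySmooth S m) :
    EntrySmooth S (fun p => f p • m p) := fun i j => hf.mul (hm i j)

theorem comp_snd {F : Type*} [NormedAddCommGroup F] [NormedSpace ℝ F] (T : Set F)
    (hm : EntrySmooth S m) : EntrySmooth (T ×ˢ S) (fun p => m p.2) := fun i j =>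
  (hm i j).comp contDiff_snd.contDiffOn fun _ hp => hp.2

theorem contDiffOn_trace (hm : EntrySmooth S m) : ContDiffOn ℝ ∞ (fun p => trace (m p)) S :=
  ContDiffOn.sum fun i _ => hm i i

end EntrySmooth

theorem contDiff_of_contDiffAt_tsupport {E F : Type*} [NormedAddCommGroup E] [NormedSpace ℝ E]
    [NormedAddCommGroup F] [NormedSpace ℝ F] {n : WithTop ℕ∞} {f : E → F}
    (h : ∀ x ∈ tsupport f, ContDiffAt ℝ n f x) : ContDiff ℝ n f := by
  refine contDiff_iff_contDiffAt.2 fun x => ?_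
  by_cases hx : x ∈ tsupport f
  · exact h x hx
  · exact contDiffAt_const.congr_of_eventuallyEq (notMem_tsupport_iff_eventuallyEq.1 hx)

theorem support_entry_subset (φ : ℝ → Mat) (i j : Fin 2) :
    Function.support (fun w => φ w i j) ⊆ Function.support φ :=
  fun w hw h => hw (by simp [h])

namespace IsTest

variable {I : Set ℝ} {φ ψ : ℝ → Mat}

theorem smoothOn (hφ : IsTest I φ) : SmoothOn I φ := fun i j => (hφ.1 i j).contDiffOn

theorem of_support_subset (hφ : IsTest I φ) (hψ : SmoothOn I ψ)
    (h : Function.support ψ ⊆ Function.support φ) : IsTest I ψ := by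
  refine ⟨fun i j => contDiff_of_contDiffAt_tsupport fun w hw => (hψ i j).contDiffAt ?_,
    hφ.2.1.mono h, (closure_mono h).trans hφ.2.2⟩
  have hw' : w ∈ tsupport φ := closure_mono ((support_entry_subset ψ i j).trans h) hw
  exact mem_interior_iff_mem_nhds.1 (hφ.2.2 hw')

theorem eq_zero (hφ : IsTest I φ) {w : ℝ} (hw : w ∉ I) : φ w = 0 :=
  image_eq_zero_of_notMem_tsupport fun h => hw (interior_subset (hφ.2.2 h))

end IsTest

/-- The space of matrix valued test functions on `I`. -/
def TestSpace (I : Set ℝ) : Submodule ℝ (ℝ → Mat) where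
  carrier := {φ | IsTest I φ}
  add_mem' {φ ψ} hφ hψ := ⟨fun i j => (hφ.1 i j).add (hψ.1 i j), hφ.2.1.add hψ.2.1,
    (tsupport_add φ ψ).trans (Set.union_subset hφ.2.2 hψ.2.2)⟩
  zero_mem' := ⟨fun _ _ => contDiff_const, HasCompactSupport.zero, by
    rw [tsupport_eq_empty_iff.2 rfl]
    exact Set.empty_subset _⟩
  smul_mem' r φ hφ := ⟨fun i j => contDiff_const.mul (hφ.1 i j), hφ.2.1.smul_left (f := fun _ => r),
    (tsupport_smul_subset_right (fun _ => r) φ).trans hφ.2.2⟩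

namespace TestSpace

variable {I : Set ℝ}

/-- Pointwise transposition of test functions. -/
def transpose : TestSpace I →ₗ[ℝ] TestSpace I where
  toFun φ := ⟨fun w => (φ.1 w)ᵀ, φ.2.of_support_subset φ.2.smoothOn.transpose
    fun w hw h => hw (by simp [h])⟩
  map_add' _ _ := rfl
  map_smul' _ _ := rfl

/-- Multiplication of test functions by a smooth function from the left. -/
def mulLeft (m : ℝ → Mat) (hm : SmoothOn I m) : TestSpace I →ₗ[ℝ] TestSpace I where
  toFun φ := ⟨fun w => m w * φ.1 w, φ.2.of_support_subset (hm.mul φ.2.smoothOn)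
    fun w hw h => hw (by simp [h])⟩
  map_add' φ ψ := Subtype.ext (funext fun w => Matrix.mul_add (m w) (φ.1 w) (ψ.1 w))
  map_smul' r φ := Subtype.ext (funext fun w => Matrix.mul_smul (m w) r (φ.1 w))

/-- Multiplication of test functions by a smooth function from the right. -/
def mulRight (m : ℝ → Mat) (hm : SmoothOn I m) : TestSpace I →ₗ[ℝ] TestSpace I where
  toFun φ := ⟨fun w => φ.1 w * m w, φ.2.of_support_subset (φ.2.smoothOn.mul hm)
    fun w hw h => hw (by simp [h])⟩
  map_add' φ ψ := Subtype.ext (funext fun w => Matrix.add_mul (φ.1 w) (ψ.1 w) (m w))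
  map_smul' r φ := Subtype.ext (funext fun w => Matrix.smul_mul r (φ.1 w) (m w))

theorem ext_apply {φ ψ : TestSpace I} (h : ∀ w, φ.1 w = ψ.1 w) : φ = ψ :=
  Subtype.ext (funext h)

theorem add_apply (φ ψ : TestSpace I) (w : ℝ) : (φ + ψ).1 w = φ.1 w + ψ.1 w := rfl

theorem smul_apply (r : ℝ) (φ : TestSpace I) (w : ℝ) : (r • φ).1 w = r • φ.1 w := rfl

theorem mulRight_apply (m : ℝ → Mat) (hm : SmoothOn I m) (φ : TestSpace I) (w : ℝ) :
    (mulRight m hm φ).1 w = φ.1 w * m w := rfl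

end TestSpace

/-! ### The principal value of the Casimir form -/

/-- The functions on which `pv` is the limit of its regularizations: `C¹` with compact support. -/
def IsAdmissible (f : ℝ → ℝ → ℝ) : Prop :=
  ContDiff ℝ 1 (fun p : ℝ × ℝ => f p.1 p.2) ∧ HasCompactSupport fun p : ℝ × ℝ => f p.1 p.2

section PrincipalValue

variable {f g : ℝ → ℝ → ℝ}

theorem IsAdmissible.integrable (hf : IsAdmissible f) {ε : ℝ} (hε : 0 < ε) :
    Integrable fun p : ℝ × ℝ => (p.1 - p.2) / ((p.1 - p.2) ^ 2 + ε ^ 2) * f p.1 p.2 := by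
  have hk : Continuous fun p : ℝ × ℝ => (p.1 - p.2) / ((p.1 - p.2) ^ 2 + ε ^ 2) :=
    Continuous.div (by fun_prop) (by fun_prop) fun p => by positivity
  exact (hk.mul hf.1.continuous).integrable_of_hasCompactSupport hf.2.mul_left

theorem pv_add (hf : IsAdmissible f) (hg : IsAdmissible g) :
    pv (fun v w => f v w + g v w) = pv f + pv g := by
  refine tendsto_nhds_unique (tendsto_pv _ (hf.1.add hg.1) (hf.2.add hg.2))
    (((tendsto_pv f hf.1 hf.2).add (tendsto_pv g hg.1 hg.2)).congr' ?_)
  filter_upwards [self_mem_nhdsWithin] with ε hε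
  rw [← integral_add (hf.integrable hε) (hg.integrable hε)]
  simp only [mul_add]

theorem pv_const_mul (hf : IsAdmissible f) (r : ℝ) :
    pv (fun v w => r * f v w) = r * pv f := by
  refine tendsto_nhds_unique (tendsto_pv _ (contDiff_const.mul hf.1) hf.2.mul_left)
    (((tendsto_pv f hf.1 hf.2).const_mul r).congr fun ε => ?_)
  simp only [← integral_const_mul, mul_left_comm]

theorem pv_sub (hf : IsAdmissible f) (hg : IsAdmissible g) :
    pv (fun v w => f v w - g v w) = pv f - pv g := by
  have h := pv_add hf (g := fun v w => -1 * g v w) ⟨contDiff_const.mul hg.1, hg.2.mul_left⟩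
  rw [pv_const_mul hg] at h
  simpa only [neg_one_mul, ← sub_eq_add_neg] using h

theorem pv_swap (hf : IsAdmissible f) : pv (fun v w => f w v) = -pv f := by
  refine tendsto_nhds_unique (tendsto_pv _ (hf.1.comp (contDiff_snd.prodMk contDiff_fst))
    (hf.2.comp_homeomorph (Homeomorph.prodComm ℝ ℝ)))
    ((tendsto_pv f hf.1 hf.2).neg.congr fun ε => ?_)
  rw [Measure.volume_eq_prod, ← integral_prod_swap, ← integral_neg]
  refine integral_congr_ae (Eventually.of_forall fun p => ?_)
  simp only [Prod.fst_swap, Prod.snd_swap]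
  rw [← neg_sub p.1 p.2, neg_sq]
  ring

end PrincipalValue

/-- The bilinear form `tr (X Y) - (tr X) (tr Y) / 2` on matrices, that is the contraction of
`X ⊗ Y` with the Casimir element `Ω`. -/
noncomputable def casimirForm : LinearMap.BilinForm ℝ Mat :=
  LinearMap.mk₂ ℝ (fun X Y => trace (X * Y) - 1 / 2 * (trace X * trace Y))
    (fun X X' Y => by
      rw [Matrix.add_mul, Matrix.trace_add, Matrix.trace_add]
      ring)
    (fun r X Y => by
      simp only [Matrix.smul_mul, Matrix.trace_smul, smul_eq_mul]
      ring)
    (fun X Y Y' => by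
      rw [Matrix.mul_add, Matrix.trace_add, Matrix.trace_add]
      ring)
    (fun r X Y => by
      simp only [Matrix.mul_smul, Matrix.trace_smul, smul_eq_mul]
      ring)

theorem casimirForm_apply (X Y : Mat) :
    casimirForm X Y = trace (X * Y) - 1 / 2 * (trace X * trace Y) := rfl

theorem casimirForm_comm (X Y : Mat) : casimirForm X Y = casimirForm Y X := by
  rw [casimirForm_apply, casimirForm_apply, Matrix.trace_mul_comm, mul_comm (trace X)]

theorem casimirForm_one_left (Y : Mat) : casimirForm 1 Y = 0 := by
  simp [casimirForm_apply]

namespace TestSpace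

variable {I : Set ℝ}

theorem isAdmissible_casimirForm (X Y : TestSpace I) :
    IsAdmissible fun v w => casimirForm (X.1 v) (Y.1 w) := by
  have hX : ∀ i j, ContDiff ℝ 1 fun p : ℝ × ℝ => X.1 p.1 i j := fun i j =>
    ((X.2.1 i j).of_le (by exact_mod_cast le_top)).comp contDiff_fst
  have hY : ∀ i j, ContDiff ℝ 1 fun p : ℝ × ℝ => Y.1 p.2 i j := fun i j =>
    ((Y.2.1 i j).of_le (by exact_mod_cast le_top)).comp contDiff_snd
  constructor
  · simp only [casimirForm_apply, Matrix.trace, Matrix.diag, Matrix.mul_apply]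
    exact (ContDiff.sum fun i _ => ContDiff.sum fun k _ => (hX i k).mul (hY k i)).sub
      (contDiff_const.mul ((ContDiff.sum fun i _ => hX i i).mul (ContDiff.sum fun i _ => hY i i)))
  · refine HasCompactSupport.intro (X.2.2.1.isCompact.prod Y.2.2.1.isCompact) fun p hp => ?_
    rcases not_and_or.1 hp with hp | hp
    · simp [image_eq_zero_of_notMem_tsupport hp]
    · simp [image_eq_zero_of_notMem_tsupport hp]

/-- The pairing `∬ p.v. 1/(v - w) ⟨X(v), Y(w)⟩ dv dw` with `⟨·, ·⟩` the Casimir form. The phase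
space bracket and the Sklyanin bracket are both expressed through it. -/
noncomputable def pvForm : LinearMap.BilinForm ℝ (TestSpace I) :=
  LinearMap.mk₂ ℝ (fun X Y => pv fun v w => casimirForm (X.1 v) (Y.1 w))
    (fun X X' Y => by
      simp only [add_apply, map_add, LinearMap.add_apply]
      exact pv_add (isAdmissible_casimirForm X Y) (isAdmissible_casimirForm X' Y))
    (fun r X Y => by
      simp only [smul_apply, map_smul, LinearMap.smul_apply, smul_eq_mul]
      exact pv_const_mul (isAdmissible_casimirForm X Y) r)
    (fun X Y Y' => by
      simp only [add_apply, map_add]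
      exact pv_add (isAdmissible_casimirForm X Y) (isAdmissible_casimirForm X Y'))
    (fun r X Y => by
      simp only [smul_apply, map_smul, smul_eq_mul]
      exact pv_const_mul (isAdmissible_casimirForm X Y) r)

theorem pvForm_apply (X Y : TestSpace I) :
    pvForm X Y = pv fun v w => casimirForm (X.1 v) (Y.1 w) := rfl

theorem pvForm_isAlt : (pvForm (I := I)).IsAlt := fun X => by
  have h := pv_swap (isAdmissible_casimirForm X X)
  simp only [casimirForm_comm (X.1 _) (X.1 _)] at h
  rw [pvForm_apply]
  linarith

/-- A test function whose values are scalar matrices. These are annihilated by `pvForm`. -/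
def IsScalarValued (X : TestSpace I) : Prop :=
  ∀ w, ∃ c : ℝ, X.1 w = c • 1

theorem IsScalarValued.pvForm_eq_zero {X : TestSpace I} (hX : IsScalarValued X) :
    pvForm X = 0 := by
  have hXY : ∀ (Y : TestSpace I) v w, casimirForm (X.1 v) (Y.1 w) = 0 := fun Y v w => by
    obtain ⟨c, hc⟩ := hX v
    rw [hc, map_smul, LinearMap.smul_apply, casimirForm_one_left, smul_zero]
  ext Y
  simp [pvForm_apply, hXY, pv, tendsto_const_nhds.limUnder_eq]

end TestSpace

/-! ### Functional derivatives -/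

/-- Entrywise differentiability at `0` of a curve of matrices. -/
def HasEntryDeriv (m : ℝ → Mat) (m' : Mat) : Prop :=
  ∀ i j, HasDerivAt (fun t => m t i j) (m' i j) 0

namespace HasEntryDeriv

variable {m n : ℝ → Mat} {m' n' : Mat}

theorem mul (hm : HasEntryDeriv m m') (hn : HasEntryDeriv n n') :
    HasEntryDeriv (fun t => m t * n t) (m' * n 0 + m 0 * n') := by
  intro i j
  simp only [Matrix.mul_apply, Matrix.add_apply, ← Finset.sum_add_distrib]
  exact HasDerivAt.fun_sum fun k _ => (hm i k).mul (hn k j)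

theorem mul_const (hm : HasEntryDeriv m m') (A : Mat) :
    HasEntryDeriv (fun t => m t * A) (m' * A) := by
  simpa using hm.mul (n := fun _ => A) (n' := 0) fun _ _ => hasDerivAt_const _ _

theorem transpose (hm : HasEntryDeriv m m') : HasEntryDeriv (fun t => (m t)ᵀ) m'ᵀ :=
  fun i j => hm j i

theorem const_mul (hm : HasEntryDeriv m m') (A : Mat) :
    HasEntryDeriv (fun t => A * m t) (A * m') := by
  simpa using (hm.transpose.mul_const Aᵀ).transpose

end HasEntryDeriv

/-- The velocity at `t = 0` of a curve in a space of matrix valued functions. -/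
noncomputable def velocity {X : Type} (e : X → ℝ → Mat) (c : ℝ → X) (w : ℝ) : Mat :=
  Matrix.of fun i j => deriv (fun t => e (c t) w i j) 0

theorem sum_sum_mul_eq_trace (A B : Mat) : ∑ i, ∑ j, A i j * B i j = trace (Aᵀ * B) := by
  rw [Finset.sum_comm]
  rfl

theorem hasDerivAt_integral_of_contDiff {F : Type*} [NormedAddCommGroup F] [NormedSpace ℝ F]
    {μ : Measure ℝ} [IsFiniteMeasureOnCompacts μ] {G : ℝ × ℝ → F} (hG : ContDiff ℝ 1 G) {K : Set ℝ}
    (hK : IsCompact K) (h0 : ∀ t, ∀ w ∉ K, G (t, w) = 0) (t₀ : ℝ) :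
    Integrable (fun w => deriv (fun t => G (t, w)) t₀) μ ∧
      HasDerivAt (fun t => ∫ w, G (t, w) ∂μ) (∫ w, deriv (fun t => G (t, w)) t₀ ∂μ) t₀ := by
  have hderiv : ∀ t w, HasDerivAt (fun t => G (t, w)) (fderiv ℝ G (t, w) (1, 0)) t := fun t w =>
    (hG.differentiable one_ne_zero (t, w)).hasFDerivAt.comp_hasDerivAt t
      ((hasDerivAt_id t).prodMk (hasDerivAt_const t w))
  have hderiv_zero : ∀ t, ∀ w ∉ K, fderiv ℝ G (t, w) (1, 0) = 0 := fun t w hw => by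
    rw [← (hderiv t w).deriv, funext fun t => h0 t w hw, deriv_const]
  have hcont : Continuous fun p => fderiv ℝ G p (1, 0) :=
    (hG.continuous_fderiv one_ne_zero).clm_apply continuous_const
  obtain ⟨C, hC⟩ := (isCompact_Icc.prod hK : IsCompact (Set.Icc (t₀ - 1) (t₀ + 1) ×ˢ K))
    |>.exists_bound_of_continuousOn hcont.continuousOn
  simp only [fun t w => (hderiv t w).deriv]
  refine hasDerivAt_integral_of_dominated_loc_of_deriv_le
    (bound := K.indicator fun _ => C) (Icc_mem_nhds (sub_one_lt t₀) (lt_add_one t₀))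
    (Eventually.of_forall fun t =>
      (hG.continuous.comp (Continuous.prodMk_right t)).aestronglyMeasurable)
    ((hG.continuous.comp (Continuous.prodMk_right t₀)).integrable_of_hasCompactSupport
      (HasCompactSupport.intro hK (h0 t₀)))
    (hcont.comp (Continuous.prodMk_right t₀)).aestronglyMeasurable
    (Eventually.of_forall fun w t ht => ?_) ?_ (Eventually.of_forall fun w t _ => hderiv t w)
  · by_cases hw : w ∈ K
    · simpa [hw] using hC (t, w) ⟨ht, hw⟩
    · simp [hw, hderiv_zero t w hw]
  · rw [integrable_indicator_iff hK.measurableSet]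
    exact integrableOn_const hK.measure_lt_top.ne

section Curves

variable {I : Set ℝ} {X : Type} {e : X → ℝ → Mat} {c : ℝ → X}

theorem IsSmoothCurve.hasEntryDeriv (hc : IsSmoothCurve I e c) {w : ℝ} (hw : w ∈ I) :
    HasEntryDeriv (fun t => e (c t) w) (velocity e c w) := fun i j => by
  have h : ContDiffOn ℝ ∞ (fun t : ℝ => e (c t) w i j) Set.univ :=
    (hc i j).comp (f := fun t : ℝ => (t, w)) (contDiff_id.prodMk contDiff_const).contDiffOn
      fun t _ => ⟨Set.mem_univ _, hw⟩
  exact ((contDiffOn_univ.1 h).differentiable (by simp) 0).hasDerivAt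

theorem HasEntryDeriv.velocity_eq {w : ℝ} {m' : Mat}
    (h : HasEntryDeriv (fun t => e (c t) w) m') : velocity e c w = m' := by
  ext i j
  exact (h i j).deriv

theorem IsSmoothCurve.contDiff_pairing (hc : IsSmoothCurve I e c) (φ : TestSpace I) :
    ContDiff ℝ ∞ (fun p : ℝ × ℝ => ∑ i, ∑ j, φ.1 p.2 i j * e (c p.1) p.2 i j) := by
  refine ContDiff.sum fun i _ => ContDiff.sum fun j _ => contDiff_of_contDiffAt_tsupport ?_
  intro p hp
  have hp' : p.2 ∈ tsupport (fun w => φ.1 w i j) :=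
    tsupport_comp_subset_preimage (fun w => φ.1 w i j) continuous_snd (tsupport_mul_subset_left hp)
  have hI : p.2 ∈ interior I := φ.2.2.2 (closure_mono (support_entry_subset φ.1 i j) hp')
  refine ((φ.2.1 i j).comp contDiff_snd).contDiffAt.mul ((hc i j).contDiffAt ?_)
  exact prod_mem_nhds univ_mem (mem_interior_iff_mem_nhds.1 hI)

theorem IsSmoothCurve.deriv_pairing (hc : IsSmoothCurve I e c) (φ : TestSpace I) (w : ℝ) :
    deriv (fun t => ∑ i, ∑ j, φ.1 w i j * e (c t) w i j) 0 =
      trace ((φ.1 w)ᵀ * velocity e c w) := by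
  rw [← sum_sum_mul_eq_trace]
  by_cases hw : w ∈ I
  · exact (HasDerivAt.fun_sum fun i _ => HasDerivAt.fun_sum fun j _ =>
      (hc.hasEntryDeriv hw i j).const_mul _).deriv
  · simp [φ.2.eq_zero hw]

theorem IsSmoothCurve.hasDerivAt_smear (hc : IsSmoothCurve I e c) (φ : TestSpace I) :
    Integrable (fun w => trace ((φ.1 w)ᵀ * velocity e c w)) ∧
      HasDerivAt (fun t => smear e φ (c t)) (∫ w, trace ((φ.1 w)ᵀ * velocity e c w)) 0 := by
  have h := hasDerivAt_integral_of_contDiff (μ := volume)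
    ((hc.contDiff_pairing φ).of_le (by exact_mod_cast le_top)) φ.2.2.1.isCompact
    (fun t w hw => by simp [image_eq_zero_of_notMem_tsupport hw]) 0
  simp only [hc.deriv_pairing] at h
  exact h

end Curves

section FunctionalDeriv

variable {I : Set ℝ} {X : Type} {e : X → ℝ → Mat} {A B : X → ℝ} {x : X} {φ ψ : TestSpace I}

theorem hasFunctionalDeriv_iff : HasFunctionalDeriv I e A x φ ↔
    ∀ c : ℝ → X, IsSmoothCurve I e c → c 0 = x →
      HasDerivAt (fun t => A (c t)) (∫ w, trace ((φ.1 w)ᵀ * velocity e c w)) 0 := by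
  simp only [← sum_sum_mul_eq_trace]
  exact and_iff_right φ.2

theorem hasFunctionalDeriv_smear (φ : TestSpace I) (x : X) :
    HasFunctionalDeriv I e (smear e φ) x φ :=
  hasFunctionalDeriv_iff.2 fun _ hc _ => (hc.hasDerivAt_smear φ).2

theorem isObservable_smear (φ : TestSpace I) : IsObservable I e (smear e φ) :=
  fun x => ⟨φ, hasFunctionalDeriv_smear φ x⟩

namespace HasFunctionalDeriv

theorem add (hA : HasFunctionalDeriv I e A x φ) (hB : HasFunctionalDeriv I e B x ψ) :
    HasFunctionalDeriv I e (A + B) x (φ + ψ : TestSpace I) := by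
  rw [hasFunctionalDeriv_iff] at *
  intro c hc h0
  refine ((hA c hc h0).add (hB c hc h0)).congr_deriv ?_
  rw [← integral_add (hc.hasDerivAt_smear φ).1 (hc.hasDerivAt_smear ψ).1]
  simp only [TestSpace.add_apply, Matrix.transpose_add, Matrix.add_mul, Matrix.trace_add]

theorem const_smul (hA : HasFunctionalDeriv I e A x φ) (r : ℝ) :
    HasFunctionalDeriv I e (r • A) x (r • φ : TestSpace I) := by
  rw [hasFunctionalDeriv_iff] at *
  intro c hc h0
  refine ((hA c hc h0).const_mul r).congr_deriv ?_
  simp only [← integral_const_mul, TestSpace.smul_apply, Matrix.transpose_smul, Matrix.smul_mul,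
    Matrix.trace_smul, smul_eq_mul]

theorem mul (hA : HasFunctionalDeriv I e A x φ) (hB : HasFunctionalDeriv I e B x ψ) :
    HasFunctionalDeriv I e (A * B) x (A x • ψ + B x • φ : TestSpace I) := by
  have hsum := hasFunctionalDeriv_iff.1 ((hB.const_smul (A x)).add (hA.const_smul (B x)))
  rw [hasFunctionalDeriv_iff] at *
  intro c hc h0
  refine ((hA c hc h0).mul (hB c hc h0)).congr_deriv ?_
  rw [(hsum c hc h0).unique (((hB c hc h0).const_mul (A x)).add ((hA c hc h0).const_mul (B x))),
    h0]
  ring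

theorem sub (hφ : HasFunctionalDeriv I e A x φ) (hψ : HasFunctionalDeriv I e A x ψ) :
    HasFunctionalDeriv I e 0 x (φ - ψ : TestSpace I) := by
  have h := hφ.add (hψ.const_smul (-1))
  rwa [neg_one_smul ℝ A, neg_one_smul ℝ ψ, ← sub_eq_add_neg, ← sub_eq_add_neg, sub_self] at h

theorem comp {Y : Type} {e' : Y → ℝ → Mat} (T : Y → X) {y : Y}
    (hA : HasFunctionalDeriv I e A (T y) φ)
    (hT : ∀ c, IsSmoothCurve I e' c → IsSmoothCurve I e fun t => T (c t))
    (hψ : ∀ c, IsSmoothCurve I e' c → c 0 = y → ∀ w ∈ I,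
      trace ((φ.1 w)ᵀ * velocity e (fun t => T (c t)) w) =
        trace ((ψ.1 w)ᵀ * velocity e' c w)) :
    HasFunctionalDeriv I e' (fun y => A (T y)) y ψ := by
  rw [hasFunctionalDeriv_iff] at *
  intro c hc h0
  refine (hA _ (hT c hc) (by rw [h0])).congr_deriv (integral_congr_ae (Eventually.of_forall ?_))
  intro w
  by_cases hw : w ∈ I
  · exact hψ c hc h0 w hw
  · simp [φ.2.eq_zero hw, ψ.2.eq_zero hw]

end HasFunctionalDeriv

theorem isTest_functionalDeriv (I : Set ℝ) (e : X → ℝ → Mat) (A : X → ℝ) (x : X) :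
    IsTest I (functionalDeriv I e A x) := by
  unfold functionalDeriv
  split_ifs with h
  · exact h.choose_spec.1
  · exact (TestSpace I).zero_mem

/-- The chosen functional derivative as an element of the space of test functions. -/
noncomputable def differential (I : Set ℝ) (e : X → ℝ → Mat) (A : X → ℝ) (x : X) : TestSpace I :=
  ⟨functionalDeriv I e A x, isTest_functionalDeriv I e A x⟩

theorem HasFunctionalDeriv.differential (hA : HasFunctionalDeriv I e A x φ) :
    HasFunctionalDeriv I e A x (differential I e A x) := by
  have h : ∃ φ, HasFunctionalDeriv I e A x φ := ⟨φ, hA⟩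
  change HasFunctionalDeriv I e A x (functionalDeriv I e A x)
  rw [functionalDeriv, dif_pos h]
  exact h.choose_spec

theorem IsObservable.hasFunctionalDeriv (hA : IsObservable I e A) (x : X) :
    HasFunctionalDeriv I e A x (differential I e A x) := by
  obtain ⟨φ, hφ⟩ := hA x
  exact HasFunctionalDeriv.differential (φ := ⟨φ, hφ.1⟩) hφ

end FunctionalDeriv

/-! ### Momenta -/

section Points

variable {I : Set ℝ}

theorem smoothOn_groupCoord (s : Group I) : SmoothOn I (groupCoord I s) := s.2.1

theorem smoothOn_phaseCoord (M : PhaseSpace I) : SmoothOn I (phaseCoord I M) := M.2.1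

theorem phaseCoord_transpose (M : PhaseSpace I) (w : ℝ) :
    (phaseCoord I M w)ᵀ = phaseCoord I M w :=
  (M.2.2.1 w).1.isHermitian

theorem groupCoord_mul_inv (s : Group I) (w : ℝ) : groupCoord I s w * groupCoord I s⁻¹ w = 1 :=
  congrArg (fun t => groupCoord I t w) (mul_inv_cancel s)

theorem groupCoord_inv_mul (s : Group I) (w : ℝ) : groupCoord I s⁻¹ w * groupCoord I s w = 1 :=
  congrArg (fun t => groupCoord I t w) (inv_mul_cancel s)

theorem phaseCoord_smul (s : Group I) (M : PhaseSpace I) (w : ℝ) :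
    phaseCoord I (s • M) w = groupCoord I s w * phaseCoord I M w * (groupCoord I s w)ᵀ := rfl

end Points

section Momenta

open TestSpace

variable {I : Set ℝ}

/-- The covector `φ` at `s` translated to the identity so that it pairs with the velocities
`ds s⁻¹`: the function `s φᵗ`. -/
def leftMomentum (s : Group I) : TestSpace I →ₗ[ℝ] TestSpace I :=
  mulLeft (groupCoord I s) (smoothOn_groupCoord s) ∘ₗ TestSpace.transpose

/-- The covector `φ` at `s` translated to the identity so that it pairs with the velocities
`s⁻¹ ds`: the function `φᵗ s`. -/
def rightMomentum (s : Group I) : TestSpace I →ₗ[ℝ] TestSpace I :=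
  mulRight (groupCoord I s) (smoothOn_groupCoord s) ∘ₗ TestSpace.transpose

/-- The momentum map of the action at `M`: the function `M (φ + φᵗ)`, which pairs with
infinitesimal generators. -/
def phaseMomentum (M : PhaseSpace I) : TestSpace I →ₗ[ℝ] TestSpace I :=
  mulLeft (phaseCoord I M) (smoothOn_phaseCoord M) ∘ₗ (LinearMap.id + TestSpace.transpose)

/-- The transpose of the tangent map at `g` of the orbit map `h ↦ h • ξ`. -/
def orbitPullback (g : Group I) (ξ : PhaseSpace I) : TestSpace I →ₗ[ℝ] TestSpace I :=
  mulRight _ ((smoothOn_groupCoord g).mul (smoothOn_phaseCoord ξ)) ∘ₗ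
    (LinearMap.id + TestSpace.transpose)

/-- The transpose of the tangent map of the action of `g` on the phase space. -/
def actionPullback (g : Group I) : TestSpace I →ₗ[ℝ] TestSpace I :=
  mulLeft _ (smoothOn_groupCoord g).transpose ∘ₗ mulRight _ (smoothOn_groupCoord g)

theorem leftMomentum_apply (s : Group I) (φ : TestSpace I) (w : ℝ) :
    (leftMomentum s φ).1 w = groupCoord I s w * (φ.1 w)ᵀ := rfl

theorem rightMomentum_apply (s : Group I) (φ : TestSpace I) (w : ℝ) :
    (rightMomentum s φ).1 w = (φ.1 w)ᵀ * groupCoord I s w := rfl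

theorem phaseMomentum_apply (M : PhaseSpace I) (φ : TestSpace I) (w : ℝ) :
    (phaseMomentum M φ).1 w = phaseCoord I M w * (φ.1 w + (φ.1 w)ᵀ) := rfl

theorem orbitPullback_apply (g : Group I) (ξ : PhaseSpace I) (φ : TestSpace I) (w : ℝ) :
    (orbitPullback g ξ φ).1 w =
      (φ.1 w + (φ.1 w)ᵀ) * (groupCoord I g w * phaseCoord I ξ w) := rfl

theorem actionPullback_apply (g : Group I) (φ : TestSpace I) (w : ℝ) :
    (actionPullback g φ).1 w = (groupCoord I g w)ᵀ * (φ.1 w * groupCoord I g w) := rfl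

theorem leftMomentum_orbitPullback (g : Group I) (ξ : PhaseSpace I) (φ : TestSpace I) :
    leftMomentum g (orbitPullback g ξ φ) = phaseMomentum (g • ξ) φ := by
  refine ext_apply fun w => ?_
  simp only [leftMomentum_apply, orbitPullback_apply, phaseMomentum_apply, phaseCoord_smul,
    Matrix.transpose_mul, Matrix.transpose_add, Matrix.transpose_transpose, phaseCoord_transpose,
    add_comm (φ.1 w)ᵀ, Matrix.mul_assoc]

theorem rightMomentum_orbitPullback (g : Group I) (ξ : PhaseSpace I) (φ : TestSpace I) :
    rightMomentum g (orbitPullback g ξ φ) = phaseMomentum ξ (actionPullback g φ) := by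
  refine ext_apply fun w => ?_
  simp only [rightMomentum_apply, orbitPullback_apply, phaseMomentum_apply, actionPullback_apply,
    Matrix.transpose_mul, Matrix.transpose_add, Matrix.transpose_transpose, phaseCoord_transpose,
    Matrix.mul_assoc, Matrix.add_mul, Matrix.mul_add, add_comm]

/-- The Sklyanin bracket at `s` as a bilinear form on functional derivatives. -/
noncomputable def sklyaninForm (s : Group I) : LinearMap.BilinForm ℝ (TestSpace I) :=
  pvForm.compl₁₂ (leftMomentum s) (leftMomentum s) -
    pvForm.compl₁₂ (rightMomentum s) (rightMomentum s)

/-- The phase space bracket at `M` as a bilinear form on functional derivatives. -/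
noncomputable def phaseForm (M : PhaseSpace I) : LinearMap.BilinForm ℝ (TestSpace I) :=
  pvForm.compl₁₂ (phaseMomentum M) (phaseMomentum M)

theorem sklyaninForm_apply (s : Group I) (φ ψ : TestSpace I) :
    sklyaninForm s φ ψ = pvForm (leftMomentum s φ) (leftMomentum s ψ) -
      pvForm (rightMomentum s φ) (rightMomentum s ψ) := rfl

theorem phaseForm_apply (M : PhaseSpace I) (φ ψ : TestSpace I) :
    phaseForm M φ ψ = pvForm (phaseMomentum M φ) (phaseMomentum M ψ) := rfl

theorem sklyaninForm_isAlt (s : Group I) : (sklyaninForm s).IsAlt := fun φ => by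
  rw [sklyaninForm_apply, pvForm_isAlt, pvForm_isAlt, sub_zero]

theorem phaseForm_isAlt (M : PhaseSpace I) : (phaseForm M).IsAlt :=
  fun φ => pvForm_isAlt (phaseMomentum M φ)

theorem sklyaninForm_orbitPullback (g : Group I) (ξ : PhaseSpace I) (φ ψ : TestSpace I) :
    sklyaninForm g (orbitPullback g ξ φ) (orbitPullback g ξ ψ) =
      phaseForm (g • ξ) φ ψ - phaseForm ξ (actionPullback g φ) (actionPullback g ψ) := by
  simp only [sklyaninForm_apply, phaseForm_apply, leftMomentum_orbitPullback,
    rightMomentum_orbitPullback]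

theorem contract_sklyaninKernel (s : Group I) (φ ψ : ℝ → Mat) (v w : ℝ) :
    contract φ ψ (sklyaninKernel I s) v w =
      casimirForm (groupCoord I s v * (φ v)ᵀ) (groupCoord I s w * (ψ w)ᵀ)
        - casimirForm ((φ v)ᵀ * groupCoord I s v) ((ψ w)ᵀ * groupCoord I s w) := by
  generalize ha : groupCoord I s v = a
  generalize hb : groupCoord I s w = b
  simp only [contract, sklyaninKernel, ha, hb, casimirForm_apply, in₁, in₂,
    ← Matrix.mul_kronecker_mul, Matrix.mul_one, Matrix.one_mul, Matrix.sub_apply, Matrix.mul_apply,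
    Fintype.sum_prod_type, Fin.sum_univ_two, Matrix.kroneckerMap_apply, Ω, Matrix.of_apply,
    Matrix.trace_fin_two, Matrix.transpose_apply, reduceIte, zero_ne_one, one_ne_zero]
  ring

theorem contract_phaseKernel (M : PhaseSpace I) (φ ψ : ℝ → Mat) (v w : ℝ) :
    contract φ ψ (phaseKernel I M) v w =
      casimirForm (phaseCoord I M v * (φ v + (φ v)ᵀ)) (phaseCoord I M w * (ψ w + (ψ w)ᵀ)) := by
  have ha' : phaseCoord I M v 1 0 = phaseCoord I M v 0 1 :=
    congrFun₂ (phaseCoord_transpose M v) 0 1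
  have hb' : phaseCoord I M w 1 0 = phaseCoord I M w 0 1 :=
    congrFun₂ (phaseCoord_transpose M w) 0 1
  generalize ha : phaseCoord I M v = a at ha' ⊢
  generalize hb : phaseCoord I M w = b at hb' ⊢
  simp only [contract, phaseKernel, ha, hb, casimirForm_apply, in₁, in₂, transpose₁, transpose₂,
    Matrix.add_apply, Matrix.mul_apply, Fintype.sum_prod_type,
    Fin.sum_univ_two, Matrix.kroneckerMap_apply, Ω, Matrix.of_apply, Matrix.trace_fin_two,
    Matrix.transpose_apply, reduceIte, zero_ne_one, one_ne_zero, ha', hb',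
    Matrix.one_apply_eq, Matrix.one_apply_ne, ne_eq, not_false_eq_true, mul_zero, zero_mul,
    mul_one, one_mul, add_zero, zero_add, sub_zero, zero_sub]
  ring

theorem pv_contract_sklyaninKernel (s : Group I) (φ ψ : TestSpace I) :
    pv (contract φ ψ (sklyaninKernel I s)) = sklyaninForm s φ ψ := by
  rw [sklyaninForm_apply, pvForm_apply, pvForm_apply, ← pv_sub (isAdmissible_casimirForm _ _)
    (isAdmissible_casimirForm _ _)]
  exact congrArg pv (funext₂ (contract_sklyaninKernel s φ ψ))

theorem pv_contract_phaseKernel (M : PhaseSpace I) (φ ψ : TestSpace I) :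
    pv (contract φ ψ (phaseKernel I M)) = phaseForm M φ ψ :=
  congrArg pv (funext₂ (contract_phaseKernel M φ ψ))

end Momenta

/-! ### Functional derivatives along the action -/

section Action

variable {I : Set ℝ}

theorem HasFunctionalDeriv.actionPullback {A : PhaseSpace I → ℝ} {φ : TestSpace I} (g : Group I)
    (ξ : PhaseSpace I) (hA : HasFunctionalDeriv I (phaseCoord I) A (g • ξ) φ) :
    HasFunctionalDeriv I (phaseCoord I) (fun η => A (g • η)) ξ (actionPullback g φ) := by
  have hg : EntrySmooth (Set.univ ×ˢ I : Set (ℝ × ℝ)) fun p => groupCoord I g p.2 :=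
    EntrySmooth.comp_snd _ (smoothOn_groupCoord g)
  refine hA.comp (fun η => g • η) (fun c hc => (hg.mul hc).mul hg.transpose) fun c hc _ w hw => ?_
  have hvel := HasEntryDeriv.velocity_eq (e := phaseCoord I) (c := fun t => g • c t)
    (((hc.hasEntryDeriv hw).const_mul (groupCoord I g w)).mul_const (groupCoord I g w)ᵀ)
  rw [hvel, actionPullback_apply, Matrix.transpose_mul, Matrix.transpose_mul,
    Matrix.transpose_transpose, ← Matrix.mul_assoc, Matrix.trace_mul_comm]
  simp only [Matrix.mul_assoc]

theorem HasFunctionalDeriv.orbitPullback {A : PhaseSpace I → ℝ} {φ : TestSpace I} (g : Group I)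
    (ξ : PhaseSpace I) (hA : HasFunctionalDeriv I (phaseCoord I) A (g • ξ) φ) :
    HasFunctionalDeriv I (groupCoord I) (fun h => A (h • ξ)) g (orbitPullback g ξ φ) := by
  have hξ : EntrySmooth (Set.univ ×ˢ I : Set (ℝ × ℝ)) fun p => phaseCoord I ξ p.2 :=
    EntrySmooth.comp_snd _ (smoothOn_phaseCoord ξ)
  refine hA.comp (fun h => h • ξ)
    (fun c hc => (EntrySmooth.mul hc hξ).mul (EntrySmooth.transpose hc)) fun c hc h0 w hw => ?_
  have hvel := HasEntryDeriv.velocity_eq (e := phaseCoord I) (c := fun t => c t • ξ)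
    (((hc.hasEntryDeriv hw).mul_const (phaseCoord I ξ w)).mul (hc.hasEntryDeriv hw).transpose)
  have hsymm : phaseCoord I ξ w 1 0 = phaseCoord I ξ w 0 1 :=
    congrFun₂ (phaseCoord_transpose ξ w) 0 1
  rw [hvel, h0, orbitPullback_apply]
  simp only [Matrix.trace_fin_two, Matrix.mul_apply, Fin.sum_univ_two, Matrix.transpose_apply,
    Matrix.add_apply, hsymm]
  ring

theorem IsObservable.comp_smul_right {A : PhaseSpace I → ℝ} (hA : IsObservable I (phaseCoord I) A)
    (ξ : PhaseSpace I) : IsObservable I (groupCoord I) (fun h => A (h • ξ)) :=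
  fun g => ⟨_, (hA.hasFunctionalDeriv (g • ξ)).orbitPullback g ξ⟩

end Action

/-! ### Uniqueness of functional derivatives -/

section Uniqueness

variable {I : Set ℝ}

/-- The curve `t ↦ 1 + t K` in the Geroch group, for `K` with nilpotent values. -/
def unipotentCurve (K : TestSpace I) (htr : ∀ w, (K.1 w).trace = 0) (hdet : ∀ w, (K.1 w).det = 0)
    (t : ℝ) : Group I :=
  ⟨fun w => ⟨1 + t • K.1 w, by
      have h₁ := htr w
      have h₂ := hdet w
      simp only [Matrix.trace_fin_two, Matrix.det_fin_two] at h₁ h₂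
      simp only [Matrix.det_fin_two, Matrix.add_apply, Matrix.smul_apply, smul_eq_mul,
        Matrix.one_apply_eq, Matrix.one_apply_ne, ne_eq, zero_ne_one, one_ne_zero,
        not_false_eq_true]
      linear_combination t * h₁ + t ^ 2 * h₂⟩,
    (EntrySmooth.const 1).add (EntrySmooth.smul contDiffOn_const K.2.smoothOn),
    fun w hw => Subtype.ext (by simp [K.2.eq_zero hw])⟩

theorem unipotentCurve_zero (K : TestSpace I) (htr : ∀ w, (K.1 w).trace = 0)
    (hdet : ∀ w, (K.1 w).det = 0) : unipotentCurve K htr hdet 0 = 1 :=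
  Subtype.ext (funext fun w => Subtype.ext (by
    change 1 + (0 : ℝ) • K.1 w = 1
    rw [zero_smul, add_zero]))

theorem isSmoothCurve_unipotentCurve (K : TestSpace I) (htr : ∀ w, (K.1 w).trace = 0)
    (hdet : ∀ w, (K.1 w).det = 0) :
    IsSmoothCurve I (groupCoord I) (unipotentCurve K htr hdet) :=
  (EntrySmooth.const 1).add
    (EntrySmooth.smul contDiff_fst.contDiffOn (EntrySmooth.comp_snd _ K.2.smoothOn))

theorem hasEntryDeriv_unipotentCurve (K : TestSpace I) (htr : ∀ w, (K.1 w).trace = 0)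
    (hdet : ∀ w, (K.1 w).det = 0) (w : ℝ) :
    HasEntryDeriv (fun t => groupCoord I (unipotentCurve K htr hdet t) w) (K.1 w) := fun i j => by
  change HasDerivAt (fun t => (1 : Mat) i j + t * K.1 w i j) (K.1 w i j) 0
  simpa using ((hasDerivAt_id (0 : ℝ)).mul_const (K.1 w i j)).const_add ((1 : Mat) i j)

theorem HasFunctionalDeriv.integral_trace_mul_leftMomentum_eq_zero {s : Group I}
    {φ : TestSpace I} (h : HasFunctionalDeriv I (groupCoord I) 0 s φ) (K : TestSpace I)
    (htr : ∀ w, (K.1 w).trace = 0) (hdet : ∀ w, (K.1 w).det = 0) :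
    ∫ w, trace (K.1 w * (leftMomentum s φ).1 w) = 0 := by
  have hc : IsSmoothCurve I (groupCoord I) fun t => unipotentCurve K htr hdet t * s :=
    EntrySmooth.mul (isSmoothCurve_unipotentCurve K htr hdet)
      (EntrySmooth.comp_snd _ (smoothOn_groupCoord s))
  have hvel : ∀ w, velocity (groupCoord I) (fun t => unipotentCurve K htr hdet t * s) w =
      K.1 w * groupCoord I s w := fun w =>
    HasEntryDeriv.velocity_eq ((hasEntryDeriv_unipotentCurve K htr hdet w).mul_const _)
  rw [← (hasFunctionalDeriv_iff.1 h _ hc (by rw [unipotentCurve_zero, one_mul])).unique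
    (hasDerivAt_const 0 0)]
  refine integral_congr_ae (Eventually.of_forall fun w => ?_)
  simp only [hvel, leftMomentum_apply]
  rw [← Matrix.mul_assoc, Matrix.trace_mul_comm]

theorem eq_zero_of_integral_mul_self_eq_zero {X : Type*} [TopologicalSpace X] [MeasurableSpace X]
    [OpensMeasurableSpace X] {μ : Measure X} [IsFiniteMeasureOnCompacts μ] [μ.IsOpenPosMeasure]
    {f : X → ℝ} (hf : Continuous f) (hf' : HasCompactSupport f) (h : ∫ x, f x * f x ∂μ = 0)
    (x : X) : f x = 0 := by
  by_contra hx
  exact ((hf.mul hf).integral_pos_of_hasCompactSupport_nonneg_nonzero hf'.mul_left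
    (fun x => mul_self_nonneg (f x)) (mul_self_ne_zero.2 hx)).ne' h

theorem exists_eq_smul_one_of_forall_trace_mul_eq_zero {X : Mat}
    (h : ∀ N : Mat, N.trace = 0 → N.det = 0 → trace (N * X) = 0) : ∃ c : ℝ, X = c • 1 := by
  have h₁ := h !![0, 1; 0, 0] (by simp [Matrix.trace_fin_two]) (by simp)
  have h₂ := h !![0, 0; 1, 0] (by simp [Matrix.trace_fin_two]) (by simp)
  have h₃ := h !![1, -1; 1, -1] (by simp [Matrix.trace_fin_two]) (by simp)
  simp only [Matrix.trace_fin_two, Matrix.mul_apply, Fin.sum_univ_two, Matrix.of_apply,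
    Matrix.cons_val', Matrix.cons_val_zero, Matrix.cons_val_one, Matrix.cons_val_fin_one]
    at h₁ h₂ h₃
  refine ⟨X 0 0, ?_⟩
  ext i j
  fin_cases i <;> fin_cases j <;> simp
  · linear_combination h₂
  · linear_combination h₁
  · linear_combination -h₃ + h₂ - h₁

theorem TestSpace.isScalarValued_of_integral_trace_mul_eq_zero {X : TestSpace I}
    (h : ∀ K : TestSpace I, (∀ w, (K.1 w).trace = 0) → (∀ w, (K.1 w).det = 0) →
      ∫ w, trace (K.1 w * X.1 w) = 0) : TestSpace.IsScalarValued X := by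
  refine fun w => exists_eq_smul_one_of_forall_trace_mul_eq_zero fun N htr hdet => ?_
  let f : ℝ → ℝ := fun w => trace (N * X.1 w)
  have hf : ContDiff ℝ ∞ f := contDiffOn_univ.1
    ((EntrySmooth.const N).mul fun i j => (X.2.1 i j).contDiffOn).contDiffOn_trace
  have hsupp : ∀ w, X.1 w = 0 → f w = 0 := fun w hw => by simp [f, hw]
  let K : TestSpace I := ⟨fun w => f w • N, X.2.of_support_subset
    (EntrySmooth.smul hf.contDiffOn (EntrySmooth.const N))
    fun w hw hX => hw (by simp [hsupp w hX])⟩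
  have hK := h K (fun w => by simp [K, htr]) (fun w => by simp [K, hdet])
  simp only [K, Matrix.smul_mul, Matrix.trace_smul, smul_eq_mul] at hK
  exact eq_zero_of_integral_mul_self_eq_zero hf.continuous
    (X.2.2.1.mono fun w hw hX => hw (hsupp w hX)) hK w

theorem rightMomentum_isScalarValued {s : Group I} {φ : TestSpace I}
    (h : TestSpace.IsScalarValued (leftMomentum s φ)) :
    TestSpace.IsScalarValued (rightMomentum s φ) := fun w => by
  obtain ⟨c, hc⟩ := h w
  refine ⟨c, ?_⟩
  calc (rightMomentum s φ).1 w
      = groupCoord I s⁻¹ w * (leftMomentum s φ).1 w * groupCoord I s w := by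
        rw [leftMomentum_apply, rightMomentum_apply, ← Matrix.mul_assoc, groupCoord_inv_mul,
          Matrix.one_mul]
    _ = c • 1 := by
        rw [hc, Matrix.mul_smul, Matrix.mul_one, Matrix.smul_mul, groupCoord_inv_mul]

namespace HasFunctionalDeriv

theorem leftMomentum_isScalarValued {s : Group I} {φ : TestSpace I}
    (h : HasFunctionalDeriv I (groupCoord I) 0 s φ) :
    TestSpace.IsScalarValued (leftMomentum s φ) :=
  TestSpace.isScalarValued_of_integral_trace_mul_eq_zero h.integral_trace_mul_leftMomentum_eq_zero

theorem phaseMomentum_isScalarValued {M : PhaseSpace I} {φ : TestSpace I}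
    (h : HasFunctionalDeriv I (phaseCoord I) 0 M φ) :
    TestSpace.IsScalarValued (phaseMomentum M φ) := by
  have h₁ := (HasFunctionalDeriv.orbitPullback 1 M (A := 0) (φ := φ)
    (by rwa [one_smul])).leftMomentum_isScalarValued
  rwa [leftMomentum_orbitPullback, one_smul] at h₁

theorem sklyaninForm_eq_zero {s : Group I} {φ : TestSpace I}
    (h : HasFunctionalDeriv I (groupCoord I) 0 s φ) : sklyaninForm s φ = 0 := by
  have hl := h.leftMomentum_isScalarValued
  ext ψ
  rw [sklyaninForm_apply, hl.pvForm_eq_zero, (rightMomentum_isScalarValued hl).pvForm_eq_zero]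
  simp

theorem phaseForm_eq_zero {M : PhaseSpace I} {φ : TestSpace I}
    (h : HasFunctionalDeriv I (phaseCoord I) 0 M φ) : phaseForm M φ = 0 := by
  ext ψ
  rw [phaseForm_apply, h.phaseMomentum_isScalarValued.pvForm_eq_zero]
  simp

end HasFunctionalDeriv

theorem isAlt_apply_eq_of_apply_sub_eq_zero {R V : Type*} [CommRing R] [AddCommGroup V]
    [Module R V] {d : LinearMap.BilinForm R V} (hd : d.IsAlt) {x x' y y' : V} (hx : d (x - x') = 0)
    (hy : d (y - y') = 0) : d x y = d x' y' := by
  have hxy : d x = d x' := sub_eq_zero.1 (by rw [← map_sub, hx])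
  have hyy : d y = d y' := sub_eq_zero.1 (by rw [← map_sub, hy])
  rw [hxy, ← hd.neg_eq y, hyy, hd.neg_eq]

theorem phaseBracket_eq_phaseForm {A B : PhaseSpace I → ℝ} {M : PhaseSpace I} {φ ψ : TestSpace I}
    (hA : HasFunctionalDeriv I (phaseCoord I) A M φ)
    (hB : HasFunctionalDeriv I (phaseCoord I) B M ψ) :
    phaseBracket I A B M = phaseForm M φ ψ :=
  (pv_contract_phaseKernel M (differential I (phaseCoord I) A M)
    (differential I (phaseCoord I) B M)).trans
    (isAlt_apply_eq_of_apply_sub_eq_zero (phaseForm_isAlt M)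
      (hA.differential.sub hA).phaseForm_eq_zero (hB.differential.sub hB).phaseForm_eq_zero)

end Uniqueness

/-! ### Brackets -/

namespace Bracket

variable {I : Set ℝ} (P : Bracket I)

theorem br_eq_br {A A' B B' : Group I → ℝ} {s : Group I} {φ ψ : TestSpace I}
    (hA : IsObservable I (groupCoord I) A) (hA' : IsObservable I (groupCoord I) A')
    (hB : IsObservable I (groupCoord I) B) (hB' : IsObservable I (groupCoord I) B')
    (hφ : HasFunctionalDeriv I (groupCoord I) A s φ)
    (hφ' : HasFunctionalDeriv I (groupCoord I) A' s φ)
    (hψ : HasFunctionalDeriv I (groupCoord I) B s ψ)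
    (hψ' : HasFunctionalDeriv I (groupCoord I) B' s ψ) : P.br A B s = P.br A' B' s := by
  rw [P.chain A A' B hA hA' hB s φ hφ hφ', P.skew A' B hA' hB,
    P.chain B B' A' hB hB' hA' s ψ hψ hψ', ← P.skew A' B' hA' hB']

/-- The value of a bracket at `s` as a bilinear form on functional derivatives. -/
noncomputable def form (s : Group I) : LinearMap.BilinForm ℝ (TestSpace I) :=
  have hobs : ∀ φ : TestSpace I, IsObservable I (groupCoord I) (smear (groupCoord I) φ) :=
    fun φ => isObservable_smear φ
  have hadd : ∀ φ φ' ψ : TestSpace I,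
      P.br (smear (groupCoord I) (φ + φ' : TestSpace I)) (smear (groupCoord I) ψ) s =
        P.br (smear (groupCoord I) φ) (smear (groupCoord I) ψ) s +
          P.br (smear (groupCoord I) φ') (smear (groupCoord I) ψ) s := fun φ φ' ψ => by
    have hsum : IsObservable I (groupCoord I) (smear (groupCoord I) φ + smear (groupCoord I) φ') :=
      fun x => ⟨_, (hasFunctionalDeriv_smear φ x).add (hasFunctionalDeriv_smear φ' x)⟩
    rw [← P.add_left _ _ _ (hobs φ) (hobs φ') (hobs ψ)]
    exact P.chain _ _ _ (hobs _) hsum (hobs ψ) s _ (hasFunctionalDeriv_smear _ s)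
      ((hasFunctionalDeriv_smear φ s).add (hasFunctionalDeriv_smear φ' s))
  have hsmul : ∀ (r : ℝ) (φ ψ : TestSpace I),
      P.br (smear (groupCoord I) (r • φ : TestSpace I)) (smear (groupCoord I) ψ) s =
        r * P.br (smear (groupCoord I) φ) (smear (groupCoord I) ψ) s := fun r φ ψ => by
    have hr : IsObservable I (groupCoord I) (r • smear (groupCoord I) φ) :=
      fun x => ⟨_, (hasFunctionalDeriv_smear φ x).const_smul r⟩
    rw [← P.smul_left _ _ _ (hobs φ) (hobs ψ)]
    exact P.chain _ _ _ (hobs _) hr (hobs ψ) s _ (hasFunctionalDeriv_smear _ s)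
      ((hasFunctionalDeriv_smear φ s).const_smul r)
  LinearMap.mk₂ ℝ (fun φ ψ => P.br (smear (groupCoord I) φ) (smear (groupCoord I) ψ) s)
    hadd hsmul
    (fun φ ψ ψ' => by
      simp only [P.skew _ _ (hobs φ) (hobs _) s, hadd, neg_add])
    (fun r φ ψ => by
      simp only [P.skew _ _ (hobs φ) (hobs _) s, hsmul, smul_eq_mul, mul_neg])

theorem form_apply (s : Group I) (φ ψ : TestSpace I) :
    P.form s φ ψ = P.br (smear (groupCoord I) φ) (smear (groupCoord I) ψ) s := rfl

theorem br_eq_form {A B : Group I → ℝ} (hA : IsObservable I (groupCoord I) A)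
    (hB : IsObservable I (groupCoord I) B) {s : Group I} {φ ψ : TestSpace I}
    (hφ : HasFunctionalDeriv I (groupCoord I) A s φ)
    (hψ : HasFunctionalDeriv I (groupCoord I) B s ψ) : P.br A B s = P.form s φ ψ :=
  P.br_eq_br hA (isObservable_smear φ) hB (isObservable_smear ψ) hφ (hasFunctionalDeriv_smear φ s)
    hψ (hasFunctionalDeriv_smear ψ s)

theorem isSklyanin_iff : P.IsSklyanin ↔ ∀ s, P.form s = sklyaninForm s := by
  constructor
  · intro h s
    ext φ ψ
    exact (h φ ψ φ.2 ψ.2 s).trans (pv_contract_sklyaninKernel s φ ψ)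
  · intro h φ ψ hφ hψ s
    exact (LinearMap.congr_fun₂ (h s) ⟨φ, hφ⟩ ⟨ψ, hψ⟩).trans
      (pv_contract_sklyaninKernel s ⟨φ, hφ⟩ ⟨ψ, hψ⟩).symm

theorem poisson_iff_form_orbitPullback {A B : PhaseSpace I → ℝ}
    (hA : IsObservable I (phaseCoord I) A) (hB : IsObservable I (phaseCoord I) B) {g : Group I}
    {ξ : PhaseSpace I} {φ ψ : TestSpace I}
    (hφ : HasFunctionalDeriv I (phaseCoord I) A (g • ξ) φ)
    (hψ : HasFunctionalDeriv I (phaseCoord I) B (g • ξ) ψ) :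
    phaseBracket I A B (g • ξ) = phaseBracket I (fun η => A (g • η)) (fun η => B (g • η)) ξ
        + P.br (fun h => A (h • ξ)) (fun h => B (h • ξ)) g ↔
      P.form g (orbitPullback g ξ φ) (orbitPullback g ξ ψ) =
        sklyaninForm g (orbitPullback g ξ φ) (orbitPullback g ξ ψ) := by
  rw [sklyaninForm_orbitPullback, phaseBracket_eq_phaseForm hφ hψ,
    phaseBracket_eq_phaseForm (hφ.actionPullback g ξ) (hψ.actionPullback g ξ),
    P.br_eq_form (hA.comp_smul_right ξ) (hB.comp_smul_right ξ) (hφ.orbitPullback g ξ)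
      (hψ.orbitPullback g ξ), eq_sub_iff_add_eq', eq_comm]

theorem actionIsPoisson_iff : P.ActionIsPoisson ↔ ∀ (g : Group I) (ξ : PhaseSpace I) φ ψ,
    P.form g (orbitPullback g ξ φ) (orbitPullback g ξ ψ) =
      sklyaninForm g (orbitPullback g ξ φ) (orbitPullback g ξ ψ) := by
  constructor
  · intro h g ξ φ ψ
    exact (P.poisson_iff_form_orbitPullback (isObservable_smear φ) (isObservable_smear ψ)
      (hasFunctionalDeriv_smear φ _) (hasFunctionalDeriv_smear ψ _)).1
      (h _ _ (isObservable_smear φ) (isObservable_smear ψ) g ξ)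
  · intro h A B hA hB g ξ
    exact (P.poisson_iff_form_orbitPullback hA hB (hA.hasFunctionalDeriv _)
      (hB.hasFunctionalDeriv _)).2 (h g ξ _ _)

/-- The bracket defined by a family of alternating bilinear forms on functional derivatives, which
have to vanish on the functional derivatives of `0` because functional derivatives are not
unique. -/
noncomputable def ofForm (d : Group I → LinearMap.BilinForm ℝ (TestSpace I))
    (hd : ∀ s, (d s).IsAlt)
    (hd₀ : ∀ s (φ : TestSpace I), HasFunctionalDeriv I (groupCoord I) 0 s φ → d s φ = 0) :
    Bracket I :=
  have hcongr : ∀ {A : Group I → ℝ} {s : Group I} {φ φ' : TestSpace I},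
      HasFunctionalDeriv I (groupCoord I) A s φ → HasFunctionalDeriv I (groupCoord I) A s φ' →
        d s φ = d s φ' := fun hφ hφ' => by
    rw [← sub_eq_zero, ← map_sub]
    exact hd₀ _ _ (hφ.sub hφ')
  { br := fun A B s => d s (differential I (groupCoord I) A s) (differential I (groupCoord I) B s)
    skew := fun A B _ _ s => ((hd s).neg_eq _ _).symm
    add_left := fun A A' B hA hA' _ s => by
      have h := (hA.hasFunctionalDeriv s).add (hA'.hasFunctionalDeriv s)
      rw [hcongr h.differential h, map_add, LinearMap.add_apply]
    smul_left := fun r A B hA _ s => by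
      have h := (hA.hasFunctionalDeriv s).const_smul r
      rw [hcongr h.differential h, map_smul, LinearMap.smul_apply, smul_eq_mul]
    leibniz := fun A A' B hA hA' _ s => by
      have h := (hA.hasFunctionalDeriv s).mul (hA'.hasFunctionalDeriv s)
      rw [hcongr h.differential h, map_add, map_smul, map_smul]
      rfl
    chain := fun A A' B _ _ _ s φ hA hA' => by
      have hA₁ : HasFunctionalDeriv I (groupCoord I) A s (⟨φ, hA.1⟩ : TestSpace I) := hA
      have hA₁' : HasFunctionalDeriv I (groupCoord I) A' s (⟨φ, hA.1⟩ : TestSpace I) := hA'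
      rw [hcongr hA₁.differential hA₁, hcongr hA₁'.differential hA₁'] }

theorem form_ofForm (d : Group I → LinearMap.BilinForm ℝ (TestSpace I)) (hd : ∀ s, (d s).IsAlt)
    (hd₀ : ∀ s (φ : TestSpace I), HasFunctionalDeriv I (groupCoord I) 0 s φ → d s φ = 0)
    (s : Group I) : (ofForm d hd hd₀).form s = d s := by
  refine LinearMap.ext₂ fun φ ψ => ?_
  have hφ : HasFunctionalDeriv I (groupCoord I) (smear (groupCoord I) φ) s φ :=
    hasFunctionalDeriv_smear φ s
  have hψ : HasFunctionalDeriv I (groupCoord I) (smear (groupCoord I) ψ) s ψ :=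
    hasFunctionalDeriv_smear ψ s
  rw [form_apply]
  exact isAlt_apply_eq_of_apply_sub_eq_zero (hd s) (hd₀ s _ (hφ.differential.sub hφ))
    (hd₀ s _ (hψ.differential.sub hψ))

theorem exists_isSklyanin : ∃ P : Bracket I, P.IsSklyanin :=
  ⟨ofForm sklyaninForm sklyaninForm_isAlt fun _ _ h => h.sklyaninForm_eq_zero,
    (isSklyanin_iff _).2 (form_ofForm _ _ _)⟩

end Bracket

/-! ### Forms that vanish along the orbit maps -/

section LocallyZero

variable {𝕜 V W U : Type*} [NontriviallyNormedField 𝕜] [TopologicalSpace V] [AddCommGroup V]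
  [Module 𝕜 V] [ContinuousAdd V] [ContinuousSMul 𝕜 V] [TopologicalSpace W] [AddCommGroup W]
  [Module 𝕜 W] [ContinuousAdd W] [ContinuousSMul 𝕜 W] [AddCommGroup U] [Module 𝕜 U]

theorem linearMap_eq_zero_of_eventually {f : V →ₗ[𝕜] U} {x₀ : V} (h : ∀ᶠ x in 𝓝 x₀, f x = 0) :
    f = 0 :=
  LinearMap.ker_eq_top.1
    (Submodule.eq_top_of_nonempty_interior' _ ⟨x₀, mem_interior_iff_mem_nhds.2 h⟩)

theorem bilinearMap_eq_zero_of_eventually {d : V →ₗ[𝕜] W →ₗ[𝕜] U} {x₀ : V} {y₀ : W}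
    (h : ∀ᶠ p : V × W in 𝓝 (x₀, y₀), d p.1 p.2 = 0) : d = 0 := by
  rw [nhds_prod_eq] at h
  exact linearMap_eq_zero_of_eventually (h.curry.mono fun x hx =>
    linearMap_eq_zero_of_eventually (f := d x) hx)

end LocallyZero

section CommonSymmetrizer

theorem posDef_of_trace_pos_of_det_pos {M : Mat} (hM : M.IsHermitian) (htr : 0 < M.trace)
    (hdet : 0 < M.det) : M.PosDef := by
  rw [hM.trace_eq_sum_eigenvalues, Fin.sum_univ_two] at htr
  rw [hM.det_eq_prod_eigenvalues, Fin.prod_univ_two] at hdet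
  simp only [RCLike.ofReal_real_eq_id, id_eq] at htr hdet
  rw [hM.posDef_iff_eigenvalues_pos, Fin.forall_fin_two]
  rcases pos_and_pos_or_neg_and_neg_of_mul_pos hdet with h | h
  · exact h
  · linarith

/-- A symmetric matrix `N` depending continuously on `E` and `F` such that `E N` and `F N` are
symmetric. Up to the factor `J` it is the commutator of `E` and `F`: a `2 × 2` matrix `A` is
traceless if and only if `A J` is symmetric, and `[E, F]`, `E [E, F]` and `F [E, F]` are
traceless. -/
def commonSymmetrizer (E F : Mat) : Mat :=
  (E * F - F * E) * !![0, -1; 1, 0]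

theorem isSymm_commonSymmetrizer (E F : Mat) : (commonSymmetrizer E F).IsSymm := by
  refine Matrix.IsSymm.ext fun i j => ?_
  fin_cases i <;> fin_cases j <;> simp [commonSymmetrizer, Matrix.mul_apply] <;> ring

theorem isSymm_mul_commonSymmetrizer_left (E F : Mat) :
    (E * commonSymmetrizer E F).IsSymm := by
  refine Matrix.IsSymm.ext fun i j => ?_
  fin_cases i <;> fin_cases j <;> simp [commonSymmetrizer, Matrix.mul_apply] <;> ring

theorem isSymm_mul_commonSymmetrizer_right (E F : Mat) :
    (F * commonSymmetrizer E F).IsSymm := by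
  refine Matrix.IsSymm.ext fun i j => ?_
  fin_cases i <;> fin_cases j <;> simp [commonSymmetrizer, Matrix.mul_apply] <;> ring

theorem continuous_commonSymmetrizer :
    Continuous fun p : Mat × Mat => commonSymmetrizer p.1 p.2 := by
  unfold commonSymmetrizer
  fun_prop

theorem eventually_exists_posDef_isSymm_mul :
    ∀ᶠ p : Mat × Mat in 𝓝 (!![1, 0; 0, -1], !![0, 1; 1, 0]),
      ∃ M : Mat, M.PosDef ∧ M.det = 1 ∧ (p.1 * M).IsSymm ∧ (p.2 * M).IsSymm := by
  have hbase : commonSymmetrizer !![1, 0; 0, -1] !![0, 1; 1, 0] = (2 : ℝ) • 1 := by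
    ext i j
    fin_cases i <;> fin_cases j <;> norm_num [commonSymmetrizer]
  have htr : ∀ᶠ p : Mat × Mat in 𝓝 (!![1, 0; 0, -1], !![0, 1; 1, 0]),
      0 < (commonSymmetrizer p.1 p.2).trace :=
    continuous_commonSymmetrizer.matrix_trace.continuousAt.eventually
      (lt_mem_nhds (by norm_num [hbase]))
  have hdet : ∀ᶠ p : Mat × Mat in 𝓝 (!![1, 0; 0, -1], !![0, 1; 1, 0]),
      0 < (commonSymmetrizer p.1 p.2).det :=
    continuous_commonSymmetrizer.matrix_det.continuousAt.eventually
      (lt_mem_nhds (by norm_num [hbase]))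
  filter_upwards [htr, hdet] with ⟨E, F⟩ htr hdet
  have hN : (commonSymmetrizer E F).PosDef :=
    posDef_of_trace_pos_of_det_pos (isSymm_commonSymmetrizer E F) htr hdet
  refine ⟨(√(commonSymmetrizer E F).det)⁻¹ • commonSymmetrizer E F,
    hN.smul (inv_pos.2 (Real.sqrt_pos.2 hdet)), ?_, ?_, ?_⟩
  · rw [Matrix.det_smul, Fintype.card_fin, inv_pow, Real.sq_sqrt hdet.le, inv_mul_cancel₀ hdet.ne']
  · rw [Matrix.mul_smul]
    exact (isSymm_mul_commonSymmetrizer_left E F).smul _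
  · rw [Matrix.mul_smul]
    exact (isSymm_mul_commonSymmetrizer_right E F).smul _

end CommonSymmetrizer

section Converse

variable {I : Set ℝ}

theorem mem_range_orbitPullback {g : Group I} {ξ : PhaseSpace I} {φ : TestSpace I}
    (h : ∀ w, ((rightMomentum g φ).1 w * phaseCoord I ξ w).IsSymm) :
    φ ∈ LinearMap.range (orbitPullback g ξ) := by
  have hsmooth := (smoothOn_groupCoord g).mul (smoothOn_phaseCoord ξ)
  refine ⟨TestSpace.mulRight _ hsmooth.adjugate ((1 / 2 : ℝ) • φ), TestSpace.ext_apply fun w => ?_⟩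
  have hw := h w
  rw [rightMomentum_apply, Matrix.mul_assoc] at hw
  rw [orbitPullback_apply, TestSpace.mulRight_apply, TestSpace.smul_apply]
  have hdet : (groupCoord I g w * phaseCoord I ξ w).det = 1 := by
    have hξ : (phaseCoord I ξ w).det = 1 := (ξ.2.2.1 w).2
    rw [Matrix.det_mul, hξ, mul_one]
    exact (g.1 w).2
  generalize groupCoord I g w * phaseCoord I ξ w = m at hw hdet ⊢
  have hadj : adjugate m * m = 1 := by rw [Matrix.adjugate_mul, hdet, one_smul]
  have hφ : φ.1 w = φ.1 w * adjugate m * m := by rw [Matrix.mul_assoc, hadj, Matrix.mul_one]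
  have hsymm : (φ.1 w * adjugate m)ᵀ = φ.1 w * adjugate m := by
    calc (φ.1 w * adjugate m)ᵀ = (adjugate m)ᵀ * ((φ.1 w)ᵀ * m) * adjugate m := by
          rw [Matrix.mul_assoc, Matrix.mul_assoc, mul_adjugate, hdet, one_smul, Matrix.mul_one,
            Matrix.transpose_mul]
      _ = (m * adjugate m)ᵀ * φ.1 w * adjugate m := by
          rw [← hw.eq]
          simp only [Matrix.transpose_mul, Matrix.transpose_transpose, Matrix.mul_assoc]
      _ = φ.1 w * adjugate m := by
          rw [mul_adjugate, hdet, one_smul, Matrix.transpose_one, Matrix.one_mul]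
  rw [Matrix.smul_mul, Matrix.transpose_smul, hsymm, ← add_smul, add_halves, one_smul, ← hφ]

open Classical in
/-- The point of the phase space with constant value `M` on `I`. -/
noncomputable def constPhase (I : Set ℝ) (M : Mat) (hM : M.PosDef) (hdet : M.det = 1) :
    PhaseSpace I :=
  ⟨fun w => if w ∈ I then M else 1,
    fun i j => (contDiffOn_const (c := M i j)).congr fun w hw => by simp only [if_pos hw],
    fun w => by beta_reduce; split_ifs; exacts [⟨hM, hdet⟩, ⟨Matrix.PosDef.one, Matrix.det_one⟩],
    fun w hw => if_neg hw⟩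

theorem phaseCoord_constPhase {M : Mat} (hM : M.PosDef) (hdet : M.det = 1) {w : ℝ} (hw : w ∈ I) :
    phaseCoord I (constPhase I M hM hdet) w = M := if_pos hw

/-- The covector at `s` with given right momentum. -/
def ofRightMomentum (s : Group I) : TestSpace I →ₗ[ℝ] TestSpace I :=
  TestSpace.transpose ∘ₗ TestSpace.mulRight (groupCoord I s⁻¹) (smoothOn_groupCoord s⁻¹)

theorem ofRightMomentum_apply (s : Group I) (X : TestSpace I) (w : ℝ) :
    (ofRightMomentum s X).1 w = (X.1 w * groupCoord I s⁻¹ w)ᵀ := rfl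

theorem rightMomentum_ofRightMomentum (s : Group I) (X : TestSpace I) :
    rightMomentum s (ofRightMomentum s X) = X := TestSpace.ext_apply fun w => by
  rw [rightMomentum_apply, ofRightMomentum_apply, Matrix.transpose_transpose, Matrix.mul_assoc,
    groupCoord_inv_mul, Matrix.mul_one]

theorem ofRightMomentum_rightMomentum (s : Group I) (φ : TestSpace I) :
    ofRightMomentum s (rightMomentum s φ) = φ := TestSpace.ext_apply fun w => by
  rw [ofRightMomentum_apply, rightMomentum_apply, Matrix.mul_assoc, groupCoord_mul_inv,
    Matrix.mul_one, Matrix.transpose_transpose]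

namespace TestSpace

/-- The test functions `w ↦ X(w)ᵢⱼ A` for a fixed matrix element of `X`. -/
def entrySMul (X : TestSpace I) (i j : Fin 2) : Mat →ₗ[ℝ] TestSpace I where
  toFun A := ⟨fun w => X.1 w i j • A, X.2.of_support_subset
    (EntrySmooth.smul (X.2.smoothOn i j) (EntrySmooth.const A)) fun w hw h => hw (by simp [h])⟩
  map_add' A B := ext_apply fun w => smul_add (X.1 w i j) A B
  map_smul' r A := ext_apply fun w => smul_comm (X.1 w i j) r A

theorem entrySMul_apply (X : TestSpace I) (i j : Fin 2) (A : Mat) (w : ℝ) :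
    (entrySMul X i j A).1 w = X.1 w i j • A := rfl

theorem sum_entrySMul_single (X : TestSpace I) :
    ∑ i, ∑ j, entrySMul X i j (Matrix.single i j 1) = X := ext_apply fun w => by
  simp only [Fin.sum_univ_two, add_apply, entrySMul_apply]
  ext i j
  fin_cases i <;> fin_cases j <;> simp

theorem bilin_eq_zero_of_entrySMul {d : LinearMap.BilinForm ℝ (TestSpace I)}
    (h : ∀ X Y i j k l, d.compl₁₂ (entrySMul X i j) (entrySMul Y k l) = 0) : d = 0 := by
  refine LinearMap.ext₂ fun X Y => ?_
  have hXY : ∀ i j k l A B, d (entrySMul X i j A) (entrySMul Y k l B) = 0 := fun i j k l A B =>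
    LinearMap.congr_fun₂ (h X Y i j k l) A B
  rw [← sum_entrySMul_single X, ← sum_entrySMul_single Y]
  simp only [map_sum, LinearMap.sum_apply, hXY, Finset.sum_const_zero, LinearMap.zero_apply]

end TestSpace

theorem ofRightMomentum_entrySMul_mem_range (s : Group I) (X : TestSpace I) (i j : Fin 2)
    {A M : Mat} (hM : M.PosDef) (hdet : M.det = 1) (hA : (A * M).IsSymm) :
    ofRightMomentum s (TestSpace.entrySMul X i j A) ∈
      LinearMap.range (orbitPullback s (constPhase I M hM hdet)) := by
  refine mem_range_orbitPullback fun w => ?_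
  rw [rightMomentum_ofRightMomentum, TestSpace.entrySMul_apply, Matrix.smul_mul]
  by_cases hw : w ∈ I
  · rw [phaseCoord_constPhase hM hdet hw]
    exact hA.smul _
  · rw [X.2.eq_zero hw, Matrix.zero_apply, zero_smul]
    exact Matrix.isSymm_zero

theorem bilin_eq_zero_of_orbitPullback {s : Group I} {d : LinearMap.BilinForm ℝ (TestSpace I)}
    (h : ∀ ξ φ ψ, d (orbitPullback s ξ φ) (orbitPullback s ξ ψ) = 0) : d = 0 := by
  have hmom : d.compl₁₂ (ofRightMomentum s) (ofRightMomentum s) = 0 := by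
    refine TestSpace.bilin_eq_zero_of_entrySMul fun X Y i j k l => ?_
    refine bilinearMap_eq_zero_of_eventually
      (eventually_exists_posDef_isSymm_mul.mono fun p ⟨M, hM, hdet, hE, hF⟩ => ?_)
    obtain ⟨φ, hφ⟩ := ofRightMomentum_entrySMul_mem_range s X i j hM hdet hE
    obtain ⟨ψ, hψ⟩ := ofRightMomentum_entrySMul_mem_range s Y k l hM hdet hF
    simp only [LinearMap.compl₁₂_apply, ← hφ, ← hψ, h]
  refine LinearMap.ext₂ fun φ ψ => ?_
  rw [← ofRightMomentum_rightMomentum s φ, ← ofRightMomentum_rightMomentum s ψ]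
  exact LinearMap.congr_fun₂ hmom _ _

theorem Bracket.actionIsPoisson_iff_isSklyanin (P : Bracket I) :
    P.ActionIsPoisson ↔ P.IsSklyanin := by
  rw [P.actionIsPoisson_iff, P.isSklyanin_iff]
  constructor
  · intro h s
    refine sub_eq_zero.1 (bilin_eq_zero_of_orbitPullback (s := s) fun ξ φ ψ => ?_)
    rw [LinearMap.sub_apply, LinearMap.sub_apply, h, sub_self]
  · intro h g ξ φ ψ
    rw [h]

end Converse

end Geroch

theorem mainTheorem1_general (I : Set ℝ) :
    (∀ P : Geroch.Bracket I, P.ActionIsPoisson ↔ P.IsSklyanin) ∧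
      ∃ P : Geroch.Bracket I, P.IsSklyanin :=
  ⟨Geroch.Bracket.actionIsPoisson_iff_isSklyanin, Geroch.Bracket.exists_isSklyanin⟩

theorem mainTheorem1 (I : Set ℝ) (hI : I.OrdConnected) (hI' : I.Nontrivial) :
    (∀ P : Geroch.Bracket I, P.ActionIsPoisson ↔ P.IsSklyanin) ∧
      ∃ P : Geroch.Bracket I, P.IsSklyanin :=
  mainTheorem1_general I
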